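/- Let $q\in\mathbb C\setminus\{0\}$ be generic ($q^k\neq 1$ for all $k\ge 1$), put $k_q=(q^k-q^{-k})/(q-q^{-1})$, and let $V=\mathbb C^N$. Let $R:V^{\otimes 2}\to V^{\otimes 2}$ be a skew-invertible Hecke symmetry, that is, $R_{12}R_{23}R_{12}=R_{23}R_{12}R_{23}$ on $V^{\otimes 3}$, $(qI-R)(q^{-1}I+R)=0$, and there is $\Psi:V^{\otimes 2}\to V^{\otimes 2}$ with $\mathrm{Tr}_{(2)}(R_{12}\Psi_{23})=P_{13}=\mathrm{Tr}_{(2)}(\Psi_{12}R_{23})$, where $P$ is the flip; put $C=\mathrm{Tr}_{(2)}\Psi$. Suppose that $R$ is even of bi-rank $(m|0)$: the $R$-skew-symmetric algebra $T(V)/\langle\mathrm{Im}(q^{-1}I+R)\rangle$ is finite-dimensional and its Hilbert–Poincaré series is a polynomial of degree $m$. Let $\mathcal L(R)$ be the reflection equation algebra, i.e. the unital associative $\mathbb C$-algebra generated by the entries of $L=\|l_i^j\|_{1\le i,j\le N}$ with the relations $R(L\otimes I)R(L\otimes I)=(L\otimes I)R(L\otimes I)R$. Let $R_k$ be the operator $R$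 acting in the tensor factors $k,k+1$, and put $L_{\overline 1}=L\otimes I\otimes\dots\otimes I$, $L_{\overline{k+1}}=R_kL_{\overline k}R_k^{-1}$. For $z$ in the Hecke algebra $\mathcal H_n(q)$ with the generators $\tau_1,\dots,\tau_{n-1}$, put $$ch(z)=\mathrm{Tr}_{(1\dots n)}\bigl(C_1\cdots C_n\,\rho_R(z)\,L_{\overline 1}L_{\overline 2}\cdots L_{\overline n}\bigr),\qquad \rho_R(\tau_k)=R_k .$$ The characteristic subalgebra is the linear span of all $ch(z)$, $z\in\mathcal H_n(q)$, $n\ge 1$. Define $a_n=ch(A^{(n)})$, where $A^{(n)}\in\mathcal H_n(q)$ is the $q$-antisymmetrizer (the primitive idempotent belonging to the partition $(1^n)$, on which every $\tau_i$ acts as $-q^{-1}$), and $a_0=1$; define $p_n=ch(\tau_{n-1}\cdots\tau_1)$ and $t_n=ch(\tau_{n-1}^{-1}\cdots\tau_1^{-1})$. Then for all $n\ge 1$ $$n_q\,a_n+\sum_{k=1}^n(-1)^kq^{\,n-k}a_{n-k}\,p_k=0,\qquad n_q\,a_n+\sum_{k=1}^n(-1)^kq^{\,k-n}a_{n-k}\,t_k=0,$$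 $$p_n=t_n+(q-q^{-1})\sum_{k=1}^{n-1}p_{n-k}\,t_k,$$ and $a_n=0$ for $n>m$. Moreover, for every $n$ the sets $\{a_k\}_{1\le k\le n}$, $\{p_k\}_{1\le k\le n}$ and $\{t_k\}_{1\le k\le n}$ generate the same (not necessarily unital) subalgebra of $\mathcal L(R)$, and each of the sets $\{a_k\}_{1\le k\le m}$, $\{p_k\}_{1\le k\le m}$, $\{t_k\}_{1\le k\le m}$ generates the characteristic subalgebra. -/

import Mathlib

open scoped Kronecker

noncomputable section

namespace RE

/-! ### Placing matrices at tensor factors -/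

section Place

variable {S : Type*} [Semiring S] {N r n s : ℕ}

/-- `A` acting in the tensor factors `f 0, …, f (r-1)` of the `n`-fold tensor power of `S ^ N`
(and as the identity in the other factors). Multi-indices are functions `Fin n → Fin N`. -/
def place (f : Fin r → Fin n) (A : Matrix (Fin r → Fin N) (Fin r → Fin N) S) :
    Matrix (Fin n → Fin N) (Fin n → Fin N) S := by
  classical
  exact Matrix.of fun x y => if ∀ j, j ∉ Set.range f → x j = y j then A (x ∘ f) (y ∘ f) else 0

theorem place_apply_pos (f : Fin r → Fin n) (A : Matrix (Fin r → Fin N) (Fin r → Fin N) S)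
    {x y : Fin n → Fin N} (h : ∀ j, j ∉ Set.range f → x j = y j) :
    place f A x y = A (x ∘ f) (y ∘ f) := by
  classical
  simp only [place, Matrix.of_apply]
  rw [if_pos h]

theorem place_apply_neg (f : Fin r → Fin n) (A : Matrix (Fin r → Fin N) (Fin r → Fin N) S)
    {x y : Fin n → Fin N} (h : ¬ ∀ j, j ∉ Set.range f → x j = y j) :
    place f A x y = 0 := by
  classical
  simp only [place, Matrix.of_apply]
  rw [if_neg h]

theorem place_add (f : Fin r → Fin n) (A B : Matrix (Fin r → Fin N) (Fin r → Fin N) S) :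
    place f (A + B) = place f A + place f B := by
  ext x y
  by_cases h : ∀ j, j ∉ Set.range f → x j = y j
  · simp [place_apply_pos f _ h]
  · simp [place_apply_neg f _ h]

theorem place_smul (f : Fin r → Fin n) (c : S) (A : Matrix (Fin r → Fin N) (Fin r → Fin N) S) :
    place f (c • A) = c • place f A := by
  ext x y
  by_cases h : ∀ j, j ∉ Set.range f → x j = y j
  · simp [place_apply_pos f _ h]
  · simp [place_apply_neg f _ h]

theorem place_one (f : Fin r → Fin n) :
    place f (1 : Matrix (Fin r → Fin N) (Fin r → Fin N) S) = 1 := by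
  ext x y
  by_cases h : ∀ j, j ∉ Set.range f → x j = y j
  · rw [place_apply_pos f _ h, Matrix.one_apply, Matrix.one_apply]
    refine if_congr ⟨fun e => ?_, fun e => by rw [e]⟩ rfl rfl
    funext j
    by_cases hj : j ∈ Set.range f
    · obtain ⟨i, rfl⟩ := hj
      exact congrFun e i
    · exact h j hj
  · rw [place_apply_neg f _ h, Matrix.one_apply_ne]
    rintro rfl
    exact h fun _ _ => rfl

theorem place_mul (f : Fin r → Fin n) (hf : Function.Injective f)
    (A B : Matrix (Fin r → Fin N) (Fin r → Fin N) S) :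
    place f (A * B) = place f A * place f B := by
  classical
  ext x y
  rw [Matrix.mul_apply]
  by_cases h : ∀ j, j ∉ Set.range f → x j = y j
  · rw [place_apply_pos f _ h, Matrix.mul_apply]
    let g : (Fin r → Fin N) → (Fin n → Fin N) := fun u => Function.extend f u x
    have hg : ∀ u, g u ∘ f = u := fun u => by
      funext i; exact hf.extend_apply u x i
    have hg' : ∀ u, ∀ j, j ∉ Set.range f → g u j = x j := fun u j hj =>
      Function.extend_apply' u x j (fun ⟨i, hi⟩ => hj ⟨i, hi⟩)
    refine Finset.sum_of_injOn g (fun u _ v _ e => by rw [← hg u, e, hg v])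
      (fun _ _ => Finset.mem_coe.2 (Finset.mem_univ _)) ?_ ?_
    · intro z _ hz
      rw [place_apply_neg f A, zero_mul]
      intro hxz
      refine hz ⟨z ∘ f, Finset.mem_coe.2 (Finset.mem_univ _), ?_⟩
      funext j
      by_cases hj : j ∈ Set.range f
      · obtain ⟨i, rfl⟩ := hj
        exact congrFun (hg (z ∘ f)) i
      · rw [hg' _ j hj, hxz j hj]
    · intro u _
      rw [place_apply_pos f A (fun j hj => (hg' u j hj).symm),
        place_apply_pos f B (fun j hj => (hg' u j hj).trans (h j hj)), hg]
  · rw [place_apply_neg f _ h]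
    symm
    refine Finset.sum_eq_zero fun z _ => ?_
    by_cases h1 : ∀ j, j ∉ Set.range f → x j = z j
    · rw [place_apply_neg f B, mul_zero]
      intro h2
      exact h fun j hj => (h1 j hj).trans (h2 j hj)
    · rw [place_apply_neg f A h1, zero_mul]

theorem place_place (f : Fin r → Fin n) (hf : Function.Injective f) (g : Fin s → Fin r)
    (A : Matrix (Fin s → Fin N) (Fin s → Fin N) S) :
    place f (place g A) = place (f ∘ g) A := by
  ext x y
  by_cases h : ∀ j, j ∉ Set.range (f ∘ g) → x j = y j
  · have h1 : ∀ j, j ∉ Set.range f → x j = y j := fun j hj =>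
      h j fun ⟨i, hi⟩ => hj ⟨g i, hi⟩
    have h2 : ∀ j, j ∉ Set.range g → (x ∘ f) j = (y ∘ f) j := fun j hj =>
      h (f j) fun ⟨i, hi⟩ => hj ⟨i, hf hi⟩
    rw [place_apply_pos _ _ h, place_apply_pos _ _ h1, place_apply_pos _ _ h2]
    rfl
  · rw [place_apply_neg _ _ h]
    by_cases h1 : ∀ j, j ∉ Set.range f → x j = y j
    · rw [place_apply_pos _ _ h1, place_apply_neg]
      intro h2
      refine h fun j hj => ?_
      by_cases hjf : j ∈ Set.range f
      · obtain ⟨i, rfl⟩ := hjf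
        exact h2 i fun ⟨k, hk⟩ => hj ⟨k, by rw [Function.comp_apply, hk]⟩
      · exact h1 j hjf
    · rw [place_apply_neg _ _ h1]

theorem place_comm {S : Type*} [CommSemiring S] (f : Fin r → Fin n) (g : Fin s → Fin n)
    (hfg : ∀ i j, f i ≠ g j)
    (A : Matrix (Fin r → Fin N) (Fin r → Fin N) S)
    (B : Matrix (Fin s → Fin N) (Fin s → Fin N) S) :
    place f A * place g B = place g B * place f A := by
  classical
  have key : ∀ {r s : ℕ} (f : Fin r → Fin n) (g : Fin s → Fin n) (_ : ∀ i j, f i ≠ g j)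
      (A : Matrix (Fin r → Fin N) (Fin r → Fin N) S)
      (B : Matrix (Fin s → Fin N) (Fin s → Fin N) S) (x y : Fin n → Fin N),
      (place f A * place g B) x y =
        if ∀ j, j ∉ Set.range f → j ∉ Set.range g → x j = y j then
          A (x ∘ f) (y ∘ f) * B (x ∘ g) (y ∘ g) else 0 := by
    intro r s f g hfg A B x y
    rw [Matrix.mul_apply]
    let z : Fin n → Fin N := fun j => if j ∈ Set.range f then y j else x j
    have zf : z ∘ f = y ∘ f := by
      funext i; simp [z]
    have zg : z ∘ g = x ∘ g := by
      funext i
      have : g i ∉ Set.range f := fun ⟨k, hk⟩ => hfg k i hk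
      simp only [z, Function.comp_apply, if_neg this]
    have hxz : ∀ j, j ∉ Set.range f → x j = z j := fun j hj => by simp only [z, if_neg hj]
    rw [Finset.sum_eq_single z]
    · rw [place_apply_pos f A hxz, zf]
      by_cases h : ∀ j, j ∉ Set.range f → j ∉ Set.range g → x j = y j
      · rw [if_pos h, place_apply_pos g B, zg]
        intro j hj
        by_cases hjf : j ∈ Set.range f
        · simp only [z, if_pos hjf]
        · rw [← hxz j hjf]; exact h j hjf hj
      · rw [if_neg h, place_apply_neg g B, mul_zero]
        intro h2
        exact h fun j hjf hjg => (hxz j hjf).trans (h2 j hjg)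
    · intro w _ hw
      by_cases h1 : ∀ j, j ∉ Set.range f → x j = w j
      · rw [place_apply_neg g B, mul_zero]
        intro h2
        refine hw (funext fun j => ?_)
        by_cases hjf : j ∈ Set.range f
        · simp only [z, if_pos hjf]
          exact h2 j fun ⟨k, hk⟩ => by
            obtain ⟨i, hi⟩ := hjf
            exact hfg i k (hi.trans hk.symm)
        · rw [← h1 j hjf, hxz j hjf]
      · rw [place_apply_neg f A h1, zero_mul]
    · intro h; exact absurd (Finset.mem_univ _) h
  ext x y
  rw [key f g hfg, key g f fun i j => (hfg j i).symm]
  refine if_congr ⟨fun h j a b => h j b a, fun h j a b => h j b a⟩ (mul_comm _ _) rfl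

end Place

section Sites

variable {S : Type*} [Semiring S] {N : ℕ}

/-- A matrix acting on the tensor square of `S ^ N`, reindexed by functions `Fin 2 → Fin N`. -/
def pairMat (R : Matrix (Fin N × Fin N) (Fin N × Fin N) S) :
    Matrix (Fin 2 → Fin N) (Fin 2 → Fin N) S :=
  Matrix.of fun u v => R (u 0, u 1) (v 0, v 1)

/-- `I ⊗ … ⊗ I ⊗ R ⊗ I ⊗ … ⊗ I` on `n` tensor factors, with `R` in the factors number `k` and
`k + 1`, factors being counted from `0`. (It is set to the identity if `k + 1 ≥ n`.) -/
def site2 (n : ℕ) (R : Matrix (Fin N × Fin N) (Fin N × Fin N) S) (k : ℕ) :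
    Matrix (Fin n → Fin N) (Fin n → Fin N) S :=
  if h : k + 1 < n then
    place (fun i : Fin 2 => (⟨k + i, by omega⟩ : Fin n)) (pairMat R)
  else 1

/-- `M ⊗ I ⊗ … ⊗ I` on `n` tensor factors. (It is set to the identity if `n = 0`.) -/
def site1 (n : ℕ) (M : Matrix (Fin N) (Fin N) S) : Matrix (Fin n → Fin N) (Fin n → Fin N) S :=
  if h : 0 < n then
    place (fun _ : Fin 1 => (⟨0, h⟩ : Fin n)) (Matrix.of fun u v => M (u 0) (v 0))
  else 1

end Sites

/-! ### Hecke symmetries -/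

/-- `q` is a nonzero complex number which is not a root of unity. -/
def IsGeneric (q : ℂ) : Prop := q ≠ 0 ∧ ∀ k : ℕ, 1 ≤ k → q ^ k ≠ 1

/-- The `q`-number `k_q = (q ^ k - q ^ (-k)) / (q - q ^ (-1))`. -/
def qNum (q : ℂ) (k : ℕ) : ℂ := (q ^ k - q⁻¹ ^ k) / (q - q⁻¹)

variable {N : ℕ}

/-- Hecke symmetries: the braid relation `R₁₂ R₂₃ R₁₂ = R₂₃ R₁₂ R₂₃` on three tensor factors and
the Hecke condition. -/
structure IsHeckeSymmetry (q : ℂ) (R : Matrix (Fin N × Fin N) (Fin N × Fin N) ℂ) : Prop where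
  ne_zero : q ≠ 0
  ne_one : q ≠ 1
  ne_neg_one : q ≠ -1
  braid : site2 3 R 0 * site2 3 R 1 * site2 3 R 0 = site2 3 R 1 * site2 3 R 0 * site2 3 R 1
  hecke : (q • 1 - R) * (q⁻¹ • 1 + R) = 0

/-- `Tr₍₂₎(X₁₂ Y₂₃)`, where `Tr₍₂₎` is the trace over the middle one of three tensor factors; the
result acts in the factors number 1 and 3. -/
def midTrace (X Y : Matrix (Fin N × Fin N) (Fin N × Fin N) ℂ) :
    Matrix (Fin N × Fin N) (Fin N × Fin N) ℂ :=
  Matrix.of fun u v => ∑ b : Fin N, ∑ c : Fin N, X (u.1, b) (v.1, c) * Y (c, u.2) (b, v.2)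

/-- The matrix of the flip. -/
def flip (N : ℕ) : Matrix (Fin N × Fin N) (Fin N × Fin N) ℂ :=
  Matrix.of fun u v => if u.1 = v.2 ∧ u.2 = v.1 then 1 else 0

/-- `Ψ` is a skew-inverse of `R`; a matrix `R` that has one is called skew-invertible. -/
structure IsSkewInverse (R Ψ : Matrix (Fin N × Fin N) (Fin N × Fin N) ℂ) : Prop where
  left : midTrace R Ψ = flip N
  right : midTrace Ψ R = flip N

/-- `C = Tr₍₂₎ Ψ`. -/
def cMat (Ψ : Matrix (Fin N × Fin N) (Fin N × Fin N) ℂ) : Matrix (Fin N) (Fin N) ℂ :=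
  Matrix.of fun i j => ∑ a : Fin N, Ψ (i, a) (j, a)

/-! ### The skew-symmetric algebra and the bi-rank -/

/-- The relations `Im (q⁻¹ I + R) = 0`, written out on the basis vectors `x_i ⊗ x_j`. -/
inductive SkewRel (q : ℂ) (R : Matrix (Fin N × Fin N) (Fin N × Fin N) ℂ) :
    FreeAlgebra ℂ (Fin N) → FreeAlgebra ℂ (Fin N) → Prop
  | rel (v : Fin N × Fin N) : SkewRel q R
      (∑ u : Fin N × Fin N, ((q⁻¹ • 1 + R : Matrix (Fin N × Fin N) (Fin N × Fin N) ℂ) u v) •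
        (FreeAlgebra.ι ℂ u.1 * FreeAlgebra.ι ℂ u.2)) 0

/-- The `R`-skew-symmetric algebra: the tensor algebra of `V = ℂ ^ N` modulo the ideal generated by
the image of `q⁻¹ I + R` in `V ⊗ V`. -/
def SkewAlgebra (q : ℂ) (R : Matrix (Fin N × Fin N) (Fin N × Fin N) ℂ) : Type :=
  RingQuot (SkewRel q R)

instance (q : ℂ) (R : Matrix (Fin N × Fin N) (Fin N × Fin N) ℂ) : Ring (SkewAlgebra q R) :=
  inferInstanceAs (Ring (RingQuot (SkewRel q R)))

instance (q : ℂ) (R : Matrix (Fin N × Fin N) (Fin N × Fin N) ℂ) : Algebra ℂ (SkewAlgebra q R) :=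
  inferInstanceAs (Algebra ℂ (RingQuot (SkewRel q R)))

/-- The quotient map onto the `R`-skew-symmetric algebra. -/
def SkewAlgebra.mk (q : ℂ) (R : Matrix (Fin N × Fin N) (Fin N × Fin N) ℂ) :
    FreeAlgebra ℂ (Fin N) →ₐ[ℂ] SkewAlgebra q R :=
  RingQuot.mkAlgHom ℂ (SkewRel q R)

/-- The homogeneous component of degree `n` of the `R`-skew-symmetric algebra. -/
def skewComponent (q : ℂ) (R : Matrix (Fin N × Fin N) (Fin N × Fin N) ℂ) (n : ℕ) :
    Submodule ℂ (SkewAlgebra q R) :=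
  Submodule.span ℂ (Set.range fun w : Fin n → Fin N =>
    SkewAlgebra.mk q R (List.ofFn fun i => FreeAlgebra.ι ℂ (w i)).prod)

/-- The Hilbert-Poincaré series of the `R`-skew-symmetric algebra. -/
def skewHilbertSeries (q : ℂ) (R : Matrix (Fin N × Fin N) (Fin N × Fin N) ℂ) : PowerSeries ℕ :=
  PowerSeries.mk fun n => Module.finrank ℂ (skewComponent q R n)

/-- `R` is even of bi-rank `(m|0)`: the `R`-skew-symmetric algebra is finite dimensional, and its
Hilbert-Poincaré series is a polynomial of degree `m`. -/
def IsEvenOfBirank (q : ℂ) (R : Matrix (Fin N × Fin N) (Fin N × Fin N) ℂ) (m : ℕ) : Prop :=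
  Module.Finite ℂ (SkewAlgebra q R) ∧
    ∃ P : Polynomial ℕ, (P : PowerSeries ℕ) = skewHilbertSeries q R ∧ P.natDegree = m

/-! ### Hecke algebras -/

/-- The defining relations of the Hecke algebra; the generator `τ_{i+1}` has the index `i`. -/
inductive HeckeRel (q : ℂ) (n : ℕ) :
    FreeAlgebra ℂ (Fin (n - 1)) → FreeAlgebra ℂ (Fin (n - 1)) → Prop
  | braid (i j : Fin (n - 1)) (h : i.val + 1 = j.val) : HeckeRel q n
      (FreeAlgebra.ι ℂ i * FreeAlgebra.ι ℂ j * FreeAlgebra.ι ℂ i)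
      (FreeAlgebra.ι ℂ j * FreeAlgebra.ι ℂ i * FreeAlgebra.ι ℂ j)
  | comm (i j : Fin (n - 1)) (h : i.val + 2 ≤ j.val) : HeckeRel q n
      (FreeAlgebra.ι ℂ i * FreeAlgebra.ι ℂ j) (FreeAlgebra.ι ℂ j * FreeAlgebra.ι ℂ i)
  | hecke (i : Fin (n - 1)) : HeckeRel q n
      ((q • 1 - FreeAlgebra.ι ℂ i) * (q⁻¹ • 1 + FreeAlgebra.ι ℂ i)) 0

/-- The Hecke algebra `H_n(q)` (which is `ℂ` for `n = 0, 1`). -/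
def HeckeAlgebra (q : ℂ) (n : ℕ) : Type := RingQuot (HeckeRel q n)

instance (q : ℂ) (n : ℕ) : Ring (HeckeAlgebra q n) :=
  inferInstanceAs (Ring (RingQuot (HeckeRel q n)))

instance (q : ℂ) (n : ℕ) : Algebra ℂ (HeckeAlgebra q n) :=
  inferInstanceAs (Algebra ℂ (RingQuot (HeckeRel q n)))

/-- The quotient map onto the Hecke algebra. -/
def HeckeAlgebra.mk (q : ℂ) (n : ℕ) : FreeAlgebra ℂ (Fin (n - 1)) →ₐ[ℂ] HeckeAlgebra q n :=
  RingQuot.mkAlgHom ℂ (HeckeRel q n)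

/-- The generator `τ_{i+1}` of `H_n(q)`. (It is set to `1` if `i + 1 ≥ n`.) -/
def tau (q : ℂ) (n i : ℕ) : HeckeAlgebra q n :=
  if h : i < n - 1 then HeckeAlgebra.mk q n (FreeAlgebra.ι ℂ ⟨i, h⟩) else 1

/-- The inverse `τ - (q - q⁻¹) 1` of the generator `τ = τ_{i+1}` of `H_n(q)`; see `tau_mul_tauInv`
and `tauInv_mul_tau`. -/
def tauInv (q : ℂ) (n i : ℕ) : HeckeAlgebra q n :=
  if i < n - 1 then tau q n i - (q - q⁻¹) • 1 else 1

theorem tau_hecke (q : ℂ) (n : ℕ) {i : ℕ} (h : i < n - 1) :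
    (q • 1 - tau q n i) * (q⁻¹ • 1 + tau q n i) = 0 := by
  have e : HeckeAlgebra.mk q n _ = HeckeAlgebra.mk q n _ :=
    RingQuot.mkAlgHom_rel ℂ (HeckeRel.hecke (q := q) (n := n) ⟨i, h⟩)
  simpa [tau, h] using e

theorem mul_sub_eq_one_of_hecke {A : Type*} [Ring A] [Algebra ℂ A] {q : ℂ} (hq : q ≠ 0) (t : A)
    (e : (q • 1 - t) * (q⁻¹ • 1 + t) = 0) : t * (t - (q - q⁻¹) • 1) = 1 := by
  have e' : (q • 1 - t) * (q⁻¹ • 1 + t) = 1 - t * (t - (q - q⁻¹) • 1) := by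
    simp only [sub_mul, mul_add, mul_sub, smul_mul_assoc, mul_smul_comm, one_mul, mul_one,
      smul_smul, sub_smul, one_smul, smul_sub, inv_mul_cancel₀ hq]
    abel
  rw [e', sub_eq_zero] at e
  exact e.symm

theorem tau_mul_tauInv {q : ℂ} (hq : q ≠ 0) (n i : ℕ) : tau q n i * tauInv q n i = 1 := by
  by_cases h : i < n - 1
  · rw [tauInv, if_pos h]
    exact mul_sub_eq_one_of_hecke hq _ (tau_hecke q n h)
  · simp [tau, tauInv, h]

theorem tauInv_mul_tau {q : ℂ} (hq : q ≠ 0) (n i : ℕ) : tauInv q n i * tau q n i = 1 := by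
  rw [← tau_mul_tauInv hq n i]
  by_cases h : i < n - 1
  · simp [tauInv, h, sub_mul, mul_sub]
  · simp [tau, tauInv, h]

/-- The `q`-antisymmetrizer of `τ_1, …, τ_{k-1}` in `H_n(q)`, for `k ≤ n`. For `k = n` this is the
primitive idempotent of `H_n(q)` that belongs to the partition `(1^n)`, that is, to the
one-dimensional representation in which every `τ_i` is `-q⁻¹`. -/
def antisymmetrizer (q : ℂ) (n : ℕ) : ℕ → HeckeAlgebra q n
  | 0 => 1
  | 1 => 1
  | k + 2 => (qNum q (k + 2))⁻¹ • (antisymmetrizer q n (k + 1) *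
      (q ^ (k + 1) • 1 - qNum q (k + 1) • tau q n k) * antisymmetrizer q n (k + 1))

/-! ### The `R`-matrix representation -/

theorem pairMat_add (A B : Matrix (Fin N × Fin N) (Fin N × Fin N) ℂ) :
    pairMat (A + B) = pairMat A + pairMat B := rfl

theorem pairMat_smul (c : ℂ) (A : Matrix (Fin N × Fin N) (Fin N × Fin N) ℂ) :
    pairMat (c • A) = c • pairMat A := rfl

theorem pairMat_one : pairMat (1 : Matrix (Fin N × Fin N) (Fin N × Fin N) ℂ) = 1 := by
  ext u v
  simp only [pairMat, Matrix.of_apply, Matrix.one_apply]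
  refine if_congr ?_ rfl rfl
  rw [Prod.mk.injEq, funext_iff, Fin.forall_fin_two]

theorem pairMat_mul (A B : Matrix (Fin N × Fin N) (Fin N × Fin N) ℂ) :
    pairMat (A * B) = pairMat A * pairMat B := by
  ext u v
  simp only [pairMat, Matrix.of_apply, Matrix.mul_apply]
  exact (Fintype.sum_equiv (finTwoArrowEquiv (Fin N)) _ _ fun w => rfl).symm

theorem site2_hecke {q : ℂ} {R : Matrix (Fin N × Fin N) (Fin N × Fin N) ℂ}
    (hR : IsHeckeSymmetry q R) (n k : ℕ) (h : k + 1 < n) :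
    (q • 1 - site2 n R k) * (q⁻¹ • 1 + site2 n R k) = 0 := by
  have hf : Function.Injective (fun i : Fin 2 => (⟨k + i, by omega⟩ : Fin n)) := by
    intro i j e
    simp only [Fin.mk.injEq] at e
    exact Fin.ext (by omega)
  have e := congrArg (fun A => place (fun i : Fin 2 => (⟨k + i, by omega⟩ : Fin n)) (pairMat A))
    hR.hecke
  simp only [site2, dif_pos h]
  rw [sub_eq_add_neg, ← neg_one_smul ℂ R] at e
  simp only [pairMat_mul, pairMat_add, pairMat_smul, pairMat_one, place_mul _ hf, place_add,
    place_smul, place_one] at e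
  rw [sub_eq_add_neg, ← neg_one_smul ℂ (place _ _), e]
  ext x y
  have h0 : pairMat (0 : Matrix (Fin N × Fin N) (Fin N × Fin N) ℂ) = 0 := rfl
  rw [h0]
  by_cases hxy : ∀ j, j ∉ Set.range (fun i : Fin 2 => (⟨k + i, by omega⟩ : Fin n)) → x j = y j
  · rw [place_apply_pos _ _ hxy]; rfl
  · rw [place_apply_neg _ _ hxy]; rfl

theorem site2_comm (R : Matrix (Fin N × Fin N) (Fin N × Fin N) ℂ) (n k l : ℕ) (h : k + 2 ≤ l) :
    site2 n R k * site2 n R l = site2 n R l * site2 n R k := by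
  by_cases hl : l + 1 < n
  · simp only [site2, dif_pos hl, dif_pos (show k + 1 < n by omega)]
    refine place_comm _ _ (fun i j e => ?_) _ _
    simp only [Fin.mk.injEq] at e
    omega
  · simp only [site2, dif_neg hl, mul_one, one_mul]

theorem site2_braid {q : ℂ} {R : Matrix (Fin N × Fin N) (Fin N × Fin N) ℂ}
    (hR : IsHeckeSymmetry q R) (n k : ℕ) (h : k + 2 < n) :
    site2 n R k * site2 n R (k + 1) * site2 n R k =
      site2 n R (k + 1) * site2 n R k * site2 n R (k + 1) := by
  have hf : Function.Injective (fun i : Fin 3 => (⟨k + i, by omega⟩ : Fin n)) := by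
    intro i j e
    simp only [Fin.mk.injEq] at e
    exact Fin.ext (by omega)
  have h0 : site2 n R k = place (fun i : Fin 3 => (⟨k + i, by omega⟩ : Fin n))
      (site2 3 R 0) := by
    simp only [site2, dif_pos (show k + 1 < n by omega), dif_pos (show 0 + 1 < 3 by omega)]
    rw [place_place _ hf]
    congr 1
    funext i
    simp
  have h1 : site2 n R (k + 1) = place (fun i : Fin 3 => (⟨k + i, by omega⟩ : Fin n))
      (site2 3 R 1) := by
    simp only [site2, dif_pos (show k + 1 + 1 < n by omega), dif_pos (show 1 + 1 < 3 by omega)]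
    rw [place_place _ hf]
    congr 1
    funext i
    simp [add_assoc]
  rw [h0, h1, ← place_mul _ hf, ← place_mul _ hf, ← place_mul _ hf, ← place_mul _ hf, hR.braid]

/-- The `R`-matrix representation of `H_n(q)` in `V ^ ⊗ n`. -/
def rho {q : ℂ} {R : Matrix (Fin N × Fin N) (Fin N × Fin N) ℂ} (hR : IsHeckeSymmetry q R)
    (n : ℕ) : HeckeAlgebra q n →ₐ[ℂ] Matrix (Fin n → Fin N) (Fin n → Fin N) ℂ :=
  RingQuot.liftAlgHom ℂ ⟨FreeAlgebra.lift ℂ fun i : Fin (n - 1) => site2 n R i, by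
    intro x y hxy
    cases hxy with
    | braid i j h =>
      simp only [map_mul, FreeAlgebra.lift_ι_apply, ← h]
      exact site2_braid hR n i (by omega)
    | comm i j h =>
      simp only [map_mul, FreeAlgebra.lift_ι_apply]
      exact site2_comm R n i j h
    | hecke i =>
      simp only [map_mul, map_sub, map_add, map_smul, map_one, map_zero, FreeAlgebra.lift_ι_apply]
      exact site2_hecke hR n i (by omega)⟩

/-! ### The reflection equation algebra -/

/-- The generating matrix over the free algebra. -/
def freeL (N : ℕ) : Matrix (Fin N) (Fin N) (FreeAlgebra ℂ (Fin N × Fin N)) :=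
  Matrix.of fun i j => FreeAlgebra.ι ℂ (i, j)

/-- The matrix `R` with its entries regarded as elements of the free algebra. -/
def freeR (R : Matrix (Fin N × Fin N) (Fin N × Fin N) ℂ) :
    Matrix (Fin N × Fin N) (Fin N × Fin N) (FreeAlgebra ℂ (Fin N × Fin N)) :=
  R.map (algebraMap ℂ (FreeAlgebra ℂ (Fin N × Fin N)))

/-- The matrix `L ⊗ I` over the free algebra. -/
def freeL1 (N : ℕ) :
    Matrix (Fin N × Fin N) (Fin N × Fin N) (FreeAlgebra ℂ (Fin N × Fin N)) :=
  freeL N ⊗ₖ (1 : Matrix (Fin N) (Fin N) (FreeAlgebra ℂ (Fin N × Fin N)))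

/-- The entries of the relation `R (L ⊗ I) R (L ⊗ I) = (L ⊗ I) R (L ⊗ I) R`. -/
inductive RERel (R : Matrix (Fin N × Fin N) (Fin N × Fin N) ℂ) :
    FreeAlgebra ℂ (Fin N × Fin N) → FreeAlgebra ℂ (Fin N × Fin N) → Prop
  | rel (u v : Fin N × Fin N) : RERel R
      ((freeR R * freeL1 N * freeR R * freeL1 N) u v)
      ((freeL1 N * freeR R * freeL1 N * freeR R) u v)

/-- The reflection equation algebra `L(R)`. -/
def REAlgebra (R : Matrix (Fin N × Fin N) (Fin N × Fin N) ℂ) : Type := RingQuot (RERel R)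

instance (R : Matrix (Fin N × Fin N) (Fin N × Fin N) ℂ) : Ring (REAlgebra R) :=
  inferInstanceAs (Ring (RingQuot (RERel R)))

instance (R : Matrix (Fin N × Fin N) (Fin N × Fin N) ℂ) : Algebra ℂ (REAlgebra R) :=
  inferInstanceAs (Algebra ℂ (RingQuot (RERel R)))

/-- The quotient map onto the reflection equation algebra. -/
def REAlgebra.mk (R : Matrix (Fin N × Fin N) (Fin N × Fin N) ℂ) :
    FreeAlgebra ℂ (Fin N × Fin N) →ₐ[ℂ] REAlgebra R :=
  RingQuot.mkAlgHom ℂ (RERel R)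

/-- The generating matrix `L` of the reflection equation algebra. -/
def genL (R : Matrix (Fin N × Fin N) (Fin N × Fin N) ℂ) : Matrix (Fin N) (Fin N) (REAlgebra R) :=
  (freeL N).map (REAlgebra.mk R)

/-- The copies `L_{\overline{k+1}}` of `L` on `n` tensor factors:
`L_{\overline 1} = L ⊗ I ⊗ … ⊗ I` and `L_{\overline{k+1}} = R_k L_{\overline k} R_k⁻¹`. -/
def copyL (R : Matrix (Fin N × Fin N) (Fin N × Fin N) ℂ) (n : ℕ) :
    ℕ → Matrix (Fin n → Fin N) (Fin n → Fin N) (REAlgebra R)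
  | 0 => site1 n (genL R)
  | k + 1 => (site2 n R k).map (algebraMap ℂ _) * copyL R n k *
      (site2 n R⁻¹ k).map (algebraMap ℂ _)

/-- The product `L_{\overline 1} L_{\overline 2} … L_{\overline n}` on `n` tensor factors. -/
def prodL (R : Matrix (Fin N × Fin N) (Fin N × Fin N) ℂ) (n : ℕ) :
    Matrix (Fin n → Fin N) (Fin n → Fin N) (REAlgebra R) :=
  ((List.range n).map (copyL R n)).prod

/-- The multiple `R`-trace `Tr (C₁ C₂ … C_n M)`; the product `C₁ C₂ … C_n` is the `n`-fold tensor
power of `C`. -/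
def rTrace {U : Type*} [Semiring U] [Algebra ℂ U] (C : Matrix (Fin N) (Fin N) ℂ) (n : ℕ)
    (M : Matrix (Fin n → Fin N) (Fin n → Fin N) U) : U :=
  ((Matrix.of fun x y : Fin n → Fin N => algebraMap ℂ U (∏ i, C (x i) (y i))) * M).trace

section Characteristic

variable {q : ℂ} {R : Matrix (Fin N × Fin N) (Fin N × Fin N) ℂ} (hR : IsHeckeSymmetry q R)
  (Ψ : Matrix (Fin N × Fin N) (Fin N × Fin N) ℂ)

/-- The map `ch : H_n(q) → L(R)`, where `Ψ` is the skew-inverse of `R`. -/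
def ch (n : ℕ) (z : HeckeAlgebra q n) : REAlgebra R :=
  rTrace (cMat Ψ) n ((rho hR n z).map (algebraMap ℂ _) * prodL R n)

/-- The characteristic subalgebra, as a linear subspace of `L(R)`: the span of the images of all
the maps `ch : H_n(q) → L(R)`, `n ≥ 1`. -/
def characteristicSpace : Submodule ℂ (REAlgebra R) :=
  Submodule.span ℂ {y | ∃ n : ℕ, 1 ≤ n ∧ ∃ z : HeckeAlgebra q n, y = ch hR Ψ n z}

/-- The elementary symmetric polynomial `a_n(L)`. -/
def elemSymm (n : ℕ) : REAlgebra R := ch hR Ψ n (antisymmetrizer q n n)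

/-- The power sum of the first kind `p_n(L) = ch (τ_{n-1} … τ_1)`. -/
def powerSum (n : ℕ) : REAlgebra R :=
  ch hR Ψ n ((List.range (n - 1)).reverse.map (tau q n)).prod

/-- The power sum of the second kind `t_n(L) = ch (τ_{n-1}⁻¹ … τ_1⁻¹)`. -/
def powerSum' (n : ℕ) : REAlgebra R :=
  ch hR Ψ n ((List.range (n - 1)).reverse.map (tauInv q n)).prod

end Characteristic

end RE

end

/-!
The multiple `R`-trace is cyclic on the image of the Hecke algebra, because `C ⊗ C` commutes with
`R` and `L_1̄ ⋯ L_n̄` commutes with every `R_k`. It is also multiplicative on two complementary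
blocks: shifting an operator from the first `n` tensor factors to the last `n` ones leaves its
`R`-trace unchanged, so `ch` of a juxtaposition of `x` and `y` is `ch x * ch y`.

The Newton identities come from the recursion expressing `A⁽ᵏ⁺¹⁾` through `A⁽ᵏ⁾ τ_k A⁽ᵏ⁾`: under
`ch`, which is cyclic, `A⁽ᵏ⁺¹⁾ τ_{n-1} ⋯ τ_{k+1}` becomes a combination of `A⁽ᵏ⁾ τ_{n-1} ⋯
τ_{k+1}`, which gives the product `a_k p_{n-k}`, and of `A⁽ᵏ⁾ τ_{n-1} ⋯ τ_k`; iterating from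
`A⁽ⁿ⁾` down to `A⁽¹⁾` gives the alternating sum. The relation of `p` and `t` replaces the factors
`τ` of `τ_{n-1} ⋯ τ_1` by `τ⁻¹ = τ - (q - q⁻¹)`, one at a time.

Every element of the Hecke algebra is a combination of products that contain the last generator at
most once, so that cyclicity reduces `ch z` to products of power sums; these generate the
characteristic subalgebra. Finally, the skew-symmetric algebra acts on tensors with the words of
length `n` acting through `A⁽ⁿ⁾`, so that `A⁽ⁿ⁾` vanishes as soon as the degree `n` component does.
-/

noncomputable section

namespace RE

/-! ### `q`-numbers -/

section QNum

variable {q : ℂ}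

theorem IsGeneric.sub_inv_ne_zero (hq : IsGeneric q) : q - q⁻¹ ≠ 0 := fun h =>
  hq.2 2 one_le_two <| by
    rw [sq]
    nth_rewrite 1 [sub_eq_zero.1 h]
    exact inv_mul_cancel₀ hq.1

theorem qNum_ne_zero (hq : IsGeneric q) {k : ℕ} (hk : 1 ≤ k) : qNum q k ≠ 0 := by
  refine div_ne_zero (fun h => hq.2 (2 * k) (by omega) ?_) hq.sub_inv_ne_zero
  rw [inv_pow, sub_eq_zero] at h
  rw [two_mul, pow_add]
  nth_rewrite 1 [h]
  exact inv_mul_cancel₀ (pow_ne_zero _ hq.1)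

theorem qNum_one (hq : IsGeneric q) : qNum q 1 = 1 := by
  rw [qNum, pow_one, pow_one, div_self hq.sub_inv_ne_zero]

theorem qNum_succ (hq : IsGeneric q) (k : ℕ) : qNum q (k + 1) = q ^ k + q⁻¹ * qNum q k := by
  have e : q ^ (k + 1) - q⁻¹ ^ (k + 1) = q ^ k * (q - q⁻¹) + q⁻¹ * (q ^ k - q⁻¹ ^ k) := by ring
  rw [qNum, qNum, e, add_div, mul_div_cancel_right₀ _ hq.sub_inv_ne_zero, mul_div_assoc]

theorem sub_qNum_mul (hq : IsGeneric q) (k : ℕ) : q ^ k - qNum q k * (q - q⁻¹) = q⁻¹ ^ k := by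
  rw [qNum, div_mul_cancel₀ _ hq.sub_inv_ne_zero, sub_sub_cancel]

theorem qNum_smul_right_cancel {V : Type*} [AddCommGroup V] [Module ℂ V] (hq : IsGeneric q)
    {k : ℕ} (hk : 1 ≤ k) {x y : V} (h : qNum q k • x = qNum q k • y) : x = y :=
  smul_right_injective V (qNum_ne_zero hq hk) h

end QNum

/-! ### Hecke families -/

section IntervalAlgebra

variable {A B : Type*} [Ring A] [Algebra ℂ A] [Ring B] [Algebra ℂ B] {t : ℕ → A}

/-- The subalgebra generated by the `t i` with `a ≤ i` and `i + 1 < b`. When `t i` acts in the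
tensor factors `i` and `i + 1`, counted from `0`, these are the generators acting inside the block
of the factors `a, …, b - 1`. -/
def intervalAlgebra (t : ℕ → A) (a b : ℕ) : Subalgebra ℂ A :=
  Algebra.adjoin ℂ (t '' {i | a ≤ i ∧ i + 1 < b})

theorem mem_intervalAlgebra {a b i : ℕ} (ha : a ≤ i) (hb : i + 1 < b) :
    t i ∈ intervalAlgebra t a b :=
  Algebra.subset_adjoin ⟨i, ⟨ha, hb⟩, rfl⟩

theorem intervalAlgebra_mono {a b c d : ℕ} (h₁ : c ≤ a) (h₂ : b ≤ d) :
    intervalAlgebra t a b ≤ intervalAlgebra t c d :=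
  Algebra.adjoin_mono <| Set.image_mono fun _ h => ⟨h₁.trans h.1, h.2.trans_le h₂⟩

theorem intervalAlgebra_le {a b : ℕ} {S : Subalgebra ℂ A}
    (h : ∀ i, a ≤ i → i + 1 < b → t i ∈ S) : intervalAlgebra t a b ≤ S :=
  Algebra.adjoin_le <| Set.image_subset_iff.2 fun i hi => h i hi.1 hi.2

theorem map_intervalAlgebra (f : A →ₐ[ℂ] B) {t' : ℕ → B} {a b j : ℕ}
    (h : ∀ i, a ≤ i → i + 1 < b → f (t i) = t' (i + j)) :
    (intervalAlgebra t a b).map f = intervalAlgebra t' (a + j) (b + j) := by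
  rw [intervalAlgebra, AlgHom.map_adjoin, intervalAlgebra]
  congr 1
  ext y
  constructor
  · rintro ⟨_, ⟨i, ⟨ha, hb⟩, rfl⟩, rfl⟩
    exact ⟨i + j, ⟨by omega, by omega⟩, (h i ha hb).symm⟩
  · rintro ⟨i, ⟨ha, hb⟩, rfl⟩
    obtain ⟨i, rfl⟩ : ∃ k, i = k + j := ⟨i - j, by omega⟩
    exact ⟨t i, ⟨i, ⟨by omega, by omega⟩, rfl⟩, h i (by omega) (by omega)⟩

theorem commute_of_mem_intervalAlgebra {a b : ℕ} {x y : A} (hx : x ∈ intervalAlgebra t a b)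
    (h : ∀ i, a ≤ i → i + 1 < b → Commute y (t i)) : Commute y x := by
  refine Algebra.commute_of_mem_adjoin_of_forall_mem_commute hx ?_
  rintro _ ⟨i, ⟨ha, hb⟩, rfl⟩
  exact h i ha hb

theorem intervalAlgebra_eq_bot {a b : ℕ} (h : b ≤ a + 1) : intervalAlgebra t a b = ⊥ := by
  refine eq_bot_iff.2 (intervalAlgebra_le fun i ha hb => ?_)
  omega

end IntervalAlgebra

section DescProd

variable {A : Type*} [Monoid A]

/-- The descending product `t (j + m - 1) ⋯ t j`. -/
def descProd (t : ℕ → A) (j : ℕ) : ℕ → A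
  | 0 => 1
  | m + 1 => t (j + m) * descProd t j m

theorem descProd_succ' (t : ℕ → A) (j : ℕ) : ∀ m, descProd t j (m + 1) = descProd t (j + 1) m * t j
  | 0 => by rw [descProd, descProd, descProd, mul_one, one_mul, add_zero]
  | m + 1 => by
    rw [descProd, descProd_succ' t j m, descProd, ← mul_assoc, Nat.add_right_comm, add_assoc]

theorem prod_map_reverse_range (t : ℕ → A) :
    ∀ m, ((List.range m).reverse.map t).prod = descProd t 0 m
  | 0 => rfl
  | m + 1 => by
    rw [List.range_succ, List.reverse_concat, List.map_cons, List.prod_cons,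
      prod_map_reverse_range t m, descProd, zero_add]

end DescProd

section Family

variable {A B : Type*} [Ring A] [Algebra ℂ A] [Ring B] [Algebra ℂ B] {q : ℂ} {n : ℕ} {t : ℕ → A}

/-- The elements `t 0, …, t (n - 2)` satisfy the relations of the Hecke algebra `H_n(q)`. -/
structure IsHeckeFamily (q : ℂ) (n : ℕ) (t : ℕ → A) : Prop where
  hecke : ∀ i, i + 1 < n → (q • 1 - t i) * (q⁻¹ • 1 + t i) = 0
  braid : ∀ i, i + 2 < n → t i * t (i + 1) * t i = t (i + 1) * t i * t (i + 1)
  comm : ∀ i j, i + 2 ≤ j → j + 1 < n → Commute (t i) (t j)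

theorem IsHeckeFamily.commute (ht : IsHeckeFamily q n t) {a b c d : ℕ} (h : b ≤ c) (hd : d ≤ n)
    {x y : A} (hx : x ∈ intervalAlgebra t a b) (hy : y ∈ intervalAlgebra t c d) : Commute x y :=
  commute_of_mem_intervalAlgebra hy fun _ hj hj' =>
    (commute_of_mem_intervalAlgebra hx fun _ _ hi =>
      (ht.comm _ _ (by omega) (by omega)).symm).symm

theorem IsHeckeFamily.commute_apply (ht : IsHeckeFamily q n t) {a k : ℕ} (hk : k + 1 < n) {x : A}
    (hx : x ∈ intervalAlgebra t a k) : Commute x (t k) :=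
  ht.commute le_rfl hk hx (mem_intervalAlgebra le_rfl (Nat.lt_succ_self _))

theorem IsHeckeFamily.mul_self (hq : q ≠ 0) (ht : IsHeckeFamily q n t) {k : ℕ} (hk : k + 1 < n) :
    t k * t k = (q - q⁻¹) • t k + 1 := by
  have h := mul_sub_eq_one_of_hecke hq (t k) (ht.hecke k hk)
  rwa [mul_sub, mul_smul_comm, mul_one, sub_eq_iff_eq_add'] at h

/-- The antisymmetrizer of `t 0, …, t (k - 2)`, given by the recursion that defines
`antisymmetrizer` but in an arbitrary algebra. -/
def asym (q : ℂ) (t : ℕ → A) : ℕ → A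
  | 0 => 1
  | 1 => 1
  | k + 2 => (qNum q (k + 2))⁻¹ • (asym q t (k + 1) *
      (q ^ (k + 1) • 1 - qNum q (k + 1) • t k) * asym q t (k + 1))

theorem qNum_smul_asym (hq : IsGeneric q) (k : ℕ) :
    qNum q (k + 2) • asym q t (k + 2) =
      asym q t (k + 1) * (q ^ (k + 1) • 1 - qNum q (k + 1) • t k) * asym q t (k + 1) := by
  rw [asym, smul_inv_smul₀ (qNum_ne_zero hq (by omega))]

theorem map_asym (φ : A →ₐ[ℂ] B) {t' : ℕ → B} :
    ∀ k, (∀ i, i + 1 < k → φ (t i) = t' i) → φ (asym q t k) = asym q t' k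
  | 0, _ => map_one φ
  | 1, _ => map_one φ
  | k + 2, h => by
    simp only [asym, map_smul, map_mul, map_sub, map_one,
      map_asym φ (k + 1) fun i hi => h i (by omega), h k (by omega)]

theorem asym_mem_intervalAlgebra (q : ℂ) (t : ℕ → A) : ∀ k, asym q t k ∈ intervalAlgebra t 0 k
  | 0 => one_mem _
  | 1 => one_mem _
  | k + 2 => by
    have ih := intervalAlgebra_mono le_rfl (k + 1).le_succ (asym_mem_intervalAlgebra q t (k + 1))
    have hk : t k ∈ intervalAlgebra t 0 (k + 2) := mem_intervalAlgebra k.zero_le (by omega)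
    exact Subalgebra.smul_mem _ (mul_mem (mul_mem ih (sub_mem
      (Subalgebra.smul_mem _ (one_mem _) _) (Subalgebra.smul_mem _ hk _))) ih) _

/-- The alternating sum `∑ (-1) ^ i q ^ (k - i) t (k - 1) ⋯ t (k - i)`, which is the factor by which
two consecutive antisymmetrizers differ. -/
def stairs (q : ℂ) (t : ℕ → A) : ℕ → A
  | 0 => 1
  | k + 1 => q ^ (k + 1) • 1 - t k * stairs q t k

theorem stairs_mem_intervalAlgebra (q : ℂ) (t : ℕ → A) :
    ∀ k, stairs q t k ∈ intervalAlgebra t 0 (k + 1)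
  | 0 => one_mem _
  | k + 1 => sub_mem (Subalgebra.smul_mem _ (one_mem _) _)
      (mul_mem (mem_intervalAlgebra k.zero_le (by omega))
        (intervalAlgebra_mono le_rfl (k + 1).le_succ (stairs_mem_intervalAlgebra q t k)))

theorem mul_stairs (hq : IsGeneric q) {a : A} : ∀ k, (∀ i, i < k → a * t i = -q⁻¹ • a) →
    a * stairs q t k = qNum q (k + 1) • a
  | 0, _ => by rw [stairs, mul_one, qNum_one hq, one_smul]
  | k + 1, h => by
    rw [stairs, mul_sub, ← mul_assoc, h k (by omega), smul_mul_assoc,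
      mul_stairs hq k fun i hi => h i (by omega), qNum_succ hq (k + 1), mul_smul_comm, mul_one,
      smul_smul, ← sub_smul, neg_mul, sub_neg_eq_add]

theorem IsHeckeFamily.mul_stairs_mul_eq_zero (ht : IsHeckeFamily q n t) {k : ℕ} (hk : k + 1 < n)
    {a : A} (ha : ∀ i, i < k → a * t i = -q⁻¹ • a) :
    a * stairs q t (k + 1) * (q⁻¹ • 1 + t k) = 0 := by
  match k, hk, ha with
  | 0, hk, _ =>
    have h1 : stairs q t 1 = q • 1 - t 0 := by rw [stairs, stairs, zero_add, pow_one, mul_one]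
    rw [h1, mul_assoc, ht.hecke 0 hk, mul_zero]
  | k + 1, hk, ha =>
    have hc : Commute (stairs q t k) (q⁻¹ • 1 + t (k + 1)) :=
      ((Commute.one_right _).smul_right _).add_right
        (ht.commute_apply hk (stairs_mem_intervalAlgebra q t k))
    have hsplit : stairs q t (k + 2) = q ^ (k + 1) • (q • 1 - t (k + 1)) +
        t (k + 1) * t k * stairs q t k := by
      rw [stairs, stairs, mul_sub, mul_smul_comm, mul_one, smul_sub, smul_smul, ← pow_succ,
        mul_assoc]
      abel
    have hbraid : t (k + 1) * t k * (q⁻¹ • 1 + t (k + 1)) =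
        (q⁻¹ • 1 + t k) * (t (k + 1) * t k) := by
      rw [mul_add, add_mul, mul_smul_comm, mul_one, smul_mul_assoc, one_mul, ← ht.braid k hk,
        mul_assoc (t k)]
    have hkill : a * (q⁻¹ • 1 + t k) = 0 := by
      rw [mul_add, ha k (by omega), mul_smul_comm, mul_one, neg_smul, add_neg_cancel]
    calc a * stairs q t (k + 2) * (q⁻¹ • 1 + t (k + 1))
        = a * (t (k + 1) * t k * (q⁻¹ • 1 + t (k + 1)) * stairs q t k) := by
          rw [mul_assoc a, hsplit, add_mul, smul_mul_assoc, ht.hecke _ hk, smul_zero, zero_add,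
            mul_assoc _ (stairs q t k), hc.eq, ← mul_assoc (t (k + 1) * t k)]
      _ = a * (q⁻¹ • 1 + t k) * (t (k + 1) * t k) * stairs q t k := by
          rw [hbraid]
          simp only [mul_assoc]
      _ = 0 := by rw [hkill, zero_mul, zero_mul]

theorem asym_succ_eq_mul_stairs (hq : IsGeneric q) {k : ℕ}
    (hfac : qNum q (k + 1) • asym q t (k + 1) = asym q t k * stairs q t k)
    (habs : asym q t (k + 1) * asym q t k = asym q t (k + 1))
    (hidem : IsIdempotentElem (asym q t (k + 1))) (hc : Commute (asym q t k) (t k)) :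
    qNum q (k + 2) • asym q t (k + 2) = asym q t (k + 1) * stairs q t (k + 1) := by
  have h : asym q t (k + 1) * (qNum q (k + 1) • t k) * asym q t (k + 1) =
      asym q t (k + 1) * t k * stairs q t k := by
    rw [mul_smul_comm, smul_mul_assoc, ← mul_smul_comm, hfac, mul_assoc, ← mul_assoc (t k),
      ← hc.eq, ← mul_assoc, ← mul_assoc, habs]
  rw [qNum_smul_asym hq, mul_sub, sub_mul, h, mul_smul_comm, mul_one, smul_mul_assoc, hidem.eq,
    stairs, mul_sub, mul_smul_comm, mul_one, mul_assoc]

theorem IsHeckeFamily.asym_succ_spec (hq : IsGeneric q) (ht : IsHeckeFamily q n t) :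
    ∀ k, k + 1 ≤ n →
      qNum q (k + 1) • asym q t (k + 1) = asym q t k * stairs q t k ∧
      asym q t (k + 1) * asym q t k = asym q t (k + 1) ∧
      IsIdempotentElem (asym q t (k + 1)) ∧
      ∀ i, i < k → asym q t (k + 1) * t i = -q⁻¹ • asym q t (k + 1)
  | 0, _ => by
    refine ⟨?_, mul_one 1, mul_one 1, fun i hi => by omega⟩
    rw [zero_add, qNum_one hq, one_smul, asym, asym, stairs, mul_one]
  | k + 1, hk => by
    obtain ⟨hfac, habs, hidem, hneg⟩ := ht.asym_succ_spec hq k (by omega)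
    have hfac' := asym_succ_eq_mul_stairs hq hfac habs hidem
      (ht.commute_apply (by omega) (asym_mem_intervalAlgebra q t k))
    have habs' : asym q t (k + 2) * asym q t (k + 1) = asym q t (k + 2) := by
      rw [asym, smul_mul_assoc, mul_assoc, hidem.eq]
    have hneg' : ∀ i, i < k + 1 → asym q t (k + 2) * t i = -q⁻¹ • asym q t (k + 2) := by
      intro i hi
      rcases Nat.lt_or_ge i k with h | h
      · rw [← habs', mul_assoc, hneg i h, mul_smul_comm]
      · obtain rfl : i = k := by omega
        have h0 := ht.mul_stairs_mul_eq_zero (by omega) hneg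
        rw [← hfac', smul_mul_assoc] at h0
        have h1 := qNum_smul_right_cancel hq (by omega) (h0.trans (smul_zero _).symm)
        rw [mul_add, mul_smul_comm, mul_one, add_comm] at h1
        rw [eq_neg_of_add_eq_zero_left h1, neg_smul]
    refine ⟨hfac', habs', qNum_smul_right_cancel hq (k := k + 2) (by omega) ?_, hneg'⟩
    rw [← mul_smul_comm, hfac', ← mul_assoc, habs', mul_stairs hq _ hneg', hfac']

theorem IsHeckeFamily.isIdempotentElem_asym (hq : IsGeneric q) (ht : IsHeckeFamily q n t) :
    ∀ {k}, k ≤ n → IsIdempotentElem (asym q t k)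
  | 0, _ => IsIdempotentElem.one
  | k + 1, hk => (ht.asym_succ_spec hq k hk).2.2.1

theorem IsHeckeFamily.asym_mul (hq : IsGeneric q) (ht : IsHeckeFamily q n t) {k i : ℕ}
    (hk : k ≤ n) (hi : i + 1 < k) : asym q t k * t i = -q⁻¹ • asym q t k := by
  obtain ⟨k, rfl⟩ := Nat.exists_eq_succ_of_ne_zero (by omega : k ≠ 0)
  exact (ht.asym_succ_spec hq k hk).2.2.2 i (by omega)

theorem descProd_sub_smul_mem (t : ℕ → A) (c : ℂ) (j : ℕ) :
    ∀ m, descProd (t - c • 1) j m ∈ intervalAlgebra t j (j + m + 1)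
  | 0 => one_mem _
  | m + 1 => mul_mem
      (sub_mem (mem_intervalAlgebra (j.le_add_right m) (by omega))
        (Subalgebra.smul_mem _ (one_mem _) c))
      (intervalAlgebra_mono le_rfl (by omega) (descProd_sub_smul_mem t c j m))

theorem map_descProd (φ : A →ₐ[ℂ] B) {t' : ℕ → B} {j k : ℕ} :
    ∀ m, (∀ i, j ≤ i → i < j + m → φ (t i) = t' (i + k)) →
      φ (descProd t j m) = descProd t' (j + k) m
  | 0, _ => map_one φ
  | m + 1, h => by
    rw [descProd, map_mul, h _ (by omega) (by omega),
      map_descProd φ m fun i h1 h2 => h i h1 (by omega), descProd, Nat.add_right_comm]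

end Family

section Recursion

variable {A V : Type*} [Ring A] [Algebra ℂ A] [AddCommGroup V] [Module ℂ V] {q : ℂ} {n : ℕ}
  {t : ℕ → A}

theorem descProd_telescope (t : ℕ → A) (c : ℂ) :
    ∀ m, descProd t 0 m = descProd (t - c • 1) 0 m +
      c • ∑ i ∈ Finset.range m, descProd (t - c • 1) (i + 1) (m - 1 - i) * descProd t 0 i
  | 0 => by simp [descProd]
  | m + 1 => by
    have e : ∀ i ∈ Finset.range m, descProd (t - c • 1) (i + 1) (m - i) * descProd t 0 i =
        (t - c • 1) m * (descProd (t - c • 1) (i + 1) (m - 1 - i) * descProd t 0 i) := by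
      intro i hi
      have hi := Finset.mem_range.1 hi
      rw [show m - i = (m - 1 - i) + 1 by omega, descProd, mul_assoc,
        show i + 1 + (m - 1 - i) = m by omega]
    have ht : t m = (t - c • 1) m + c • 1 := (sub_add_cancel (t m) (c • 1)).symm
    calc descProd t 0 (m + 1) = (t - c • 1) m * descProd t 0 m + c • descProd t 0 m := by
          rw [descProd, zero_add, ht, add_mul, smul_mul_assoc, one_mul]
      _ = descProd (t - c • 1) 0 (m + 1) + c • ((t - c • 1) m * ∑ i ∈ Finset.range m,
            descProd (t - c • 1) (i + 1) (m - 1 - i) * descProd t 0 i + descProd t 0 m) := by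
          nth_rewrite 1 [descProd_telescope t c m]
          rw [mul_add, mul_smul_comm, smul_add, add_assoc, descProd, zero_add]
      _ = _ := by
          rw [Finset.sum_range_succ, Nat.add_sub_cancel, Finset.sum_congr rfl e, Finset.mul_sum,
            Nat.sub_self, descProd, one_mul]

variable {φ : A →ₗ[ℂ] V}

theorem IsHeckeFamily.qNum_smul_map_mul_asym (hq : IsGeneric q) (ht : IsHeckeFamily q n t)
    (hφ : ∀ x, ∀ y ∈ intervalAlgebra t 0 n, φ (x * y) = φ (y * x)) {r c : ℂ}
    (hr : ∀ k, r ^ k = q ^ k - qNum q k * c) {j m : ℕ} (hj : j + m + 2 = n) :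
    qNum q (j + 2) • φ (descProd (t - c • 1) (j + 1) m * asym q t (j + 2)) =
      r ^ (j + 1) • φ (asym q t (j + 1) * descProd (t - c • 1) (j + 1) m) -
        qNum q (j + 1) • φ (descProd (t - c • 1) j (m + 1) * asym q t (j + 1)) := by
  set s := t - c • 1
  set a := asym q t (j + 1)
  have hc : Commute a (descProd s (j + 1) m) :=
    ht.commute le_rfl (by omega) (asym_mem_intervalAlgebra q t _) (descProd_sub_smul_mem t c _ m)
  have hi : a * a = a := ht.isIdempotentElem_asym hq (by omega)
  have hs : q ^ (j + 1) • 1 - qNum q (j + 1) • t j =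
      r ^ (j + 1) • 1 - qNum q (j + 1) • s j := by
    rw [hr, sub_smul, mul_smul, show s j = t j - c • 1 from rfl, smul_sub]
    abel
  have hend : φ (descProd s (j + 1) m * (a * s j * a)) = φ (descProd s j (m + 1) * a) :=
    calc φ (descProd s (j + 1) m * (a * s j * a)) = φ (a * (descProd s (j + 1) m * s j * a)) := by
          rw [mul_assoc a, ← mul_assoc, ← hc.eq, mul_assoc a, mul_assoc (descProd s (j + 1) m)]
      _ = φ (descProd s (j + 1) m * s j * a) := by
          rw [← hφ _ _ (intervalAlgebra_mono le_rfl (by omega) (asym_mem_intervalAlgebra q t _)),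
            mul_assoc _ a, hi]
      _ = _ := by rw [descProd_succ']
  rw [← map_smul, ← mul_smul_comm, qNum_smul_asym hq, hs, mul_sub, sub_mul, mul_sub, map_sub,
    mul_smul_comm, mul_one, smul_mul_assoc, hi, mul_smul_comm, map_smul, ← hc.eq, mul_smul_comm,
    smul_mul_assoc, mul_smul_comm, map_smul, hend]

theorem IsHeckeFamily.newton_recursion (hq : IsGeneric q) (ht : IsHeckeFamily q n t)
    (hφ : ∀ x, ∀ y ∈ intervalAlgebra t 0 n, φ (x * y) = φ (y * x)) {r c : ℂ}
    (hr : ∀ k, r ^ k = q ^ k - qNum q k * c) :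
    ∀ j m, j + m + 1 = n →
      qNum q (j + 1) • φ (descProd (t - c • 1) j m * asym q t (j + 1)) =
        ∑ i ∈ Finset.range (j + 1), ((-1) ^ (j - i) * r ^ i) •
          φ (asym q t i * descProd (t - c • 1) i (n - 1 - i))
  | 0, m, hj => by
    have : n - 1 = m := by omega
    simp [qNum_one hq, asym, this]
  | j + 1, m, hj => by
    rw [ht.qNum_smul_map_mul_asym hq hφ hr (by omega),
      ht.newton_recursion hq hφ hr j (m + 1) (by omega), Finset.sum_range_succ _ (j + 1),
      Nat.sub_self, pow_zero, one_mul, show n - 1 - (j + 1) = m by omega, sub_eq_neg_add,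
      ← Finset.sum_neg_distrib]
    congr 1
    refine Finset.sum_congr rfl fun i hi => ?_
    have hi := Finset.mem_range.1 hi
    rw [← neg_smul, Nat.succ_sub (by omega), pow_succ]
    congr 1
    ring

end Recursion

section Spanning

section Semiring

variable {K A : Type*} [CommSemiring K] [Semiring A] [Algebra K A]

theorem toSubmodule_adjoin_union_le {S : Subalgebra K A} {T : Submodule K A}
    (h : T * S.toSubmodule * T ≤ S.toSubmodule ⊔ S.toSubmodule * T * S.toSubmodule) :
    (Algebra.adjoin K (S ∪ T : Set A)).toSubmodule ≤
      S.toSubmodule ⊔ S.toSubmodule * T * S.toSubmodule := by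
  set s := S.toSubmodule
  set M := s ⊔ s * T * s
  have hs : s * s = s := S.isIdempotentElem_toSubmodule
  have h1 : (1 : A) ∈ s := one_mem S
  have hleft : s * M ≤ M := by
    rw [Submodule.mul_sup, ← mul_assoc, ← mul_assoc, hs]
  have hright : M * s ≤ M := by
    rw [Submodule.sup_mul, mul_assoc (s * T), hs]
  have hMM : M * M ≤ M := by
    have e : s * T * s * (s * T * s) = s * (T * s * T) * s := by
      rw [mul_assoc (s * T), ← mul_assoc s (s * T), ← mul_assoc s s, hs]
      simp only [mul_assoc]
    have hTT : s * T * s * (s * T * s) ≤ M := by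
      rw [e]
      exact (mul_le_mul_left ((mul_le_mul_right h s).trans hleft) s).trans hright
    change (s ⊔ s * T * s) * M ≤ M
    rw [Submodule.sup_mul]
    refine sup_le hleft ?_
    change s * T * s * (s ⊔ s * T * s) ≤ M
    rw [Submodule.mul_sup, mul_assoc (s * T), hs]
    exact sup_le le_sup_right hTT
  have hsT : (S ∪ T : Set A) ⊆ M := by
    refine Set.union_subset (fun x hx => Submodule.mem_sup_left hx) fun x hx => ?_
    refine Submodule.mem_sup_right ?_
    simpa using Submodule.mul_mem_mul (Submodule.mul_mem_mul h1 hx) h1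
  let M' : Subalgebra K A := M.toSubalgebra (Submodule.mem_sup_left h1)
    fun x y hx hy => hMM (Submodule.mul_mem_mul hx hy)
  exact Algebra.adjoin_le (S := M') hsT

theorem mul_mul_le_of_braid {S S' T U : Submodule K A} (hSS : IsIdempotentElem S) (h1 : 1 ≤ S)
    (hS' : S' ≤ S) (hU : U ≤ S) (hS : S ≤ S' ⊔ S' * U * S') (hcomm : T * S' = S' * T)
    (hTT : T * T ≤ 1 ⊔ T) (hbraid : T * U * T = U * T * U) : T * S * T ≤ S ⊔ S * T * S :=
  calc T * S * T ≤ T * (S' ⊔ S' * U * S') * T := by gcongr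
    _ = S' * (T * T) ⊔ S' * (T * U * T) * S' := by
        rw [Submodule.mul_sup, Submodule.sup_mul, hcomm, mul_assoc S']
        congr 1
        calc T * (S' * U * S') * T = T * S' * U * (S' * T) := by simp only [mul_assoc]
          _ = S' * T * U * (T * S') := by rw [hcomm]
          _ = S' * (T * U * T) * S' := by simp only [mul_assoc]
    _ ≤ S' * (1 ⊔ T) ⊔ S' * (U * T * U) * S' := by
        rw [hbraid]
        gcongr
    _ = S' ⊔ S' * T * 1 ⊔ S' * U * T * (U * S') := by
        simp only [Submodule.mul_sup, mul_one, mul_assoc]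
    _ ≤ S ⊔ S * T * S ⊔ S * S * T * (S * S) := by gcongr
    _ = S ⊔ S * T * S := by rw [hSS.eq, sup_assoc, sup_idem]

end Semiring

variable {A V : Type*} [Ring A] [Algebra ℂ A] [AddCommGroup V] [Module ℂ V] {q : ℂ} {n : ℕ}
  {t : ℕ → A}

theorem IsHeckeFamily.span_mul_span_le (hq : q ≠ 0) (ht : IsHeckeFamily q n t) {k : ℕ}
    (hk : k + 1 < n) :
    Submodule.span ℂ {t k} * Submodule.span ℂ {t k} ≤ 1 ⊔ Submodule.span ℂ {t k} := by
  rw [Submodule.span_mul_span, Set.singleton_mul_singleton, Submodule.span_singleton_le_iff_mem,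
    ht.mul_self hq hk, add_comm]
  exact Submodule.add_mem_sup (Submodule.one_le.1 le_rfl)
    (Submodule.smul_mem _ _ (Submodule.mem_span_singleton_self _))

theorem IsHeckeFamily.span_mul_span_mul_span (ht : IsHeckeFamily q n t) {k : ℕ} (hk : k + 2 < n) :
    Submodule.span ℂ {t (k + 1)} * Submodule.span ℂ {t k} * Submodule.span ℂ {t (k + 1)} =
      Submodule.span ℂ {t k} * Submodule.span ℂ {t (k + 1)} * Submodule.span ℂ {t k} := by
  simp only [Submodule.span_mul_span, Set.singleton_mul_singleton, ht.braid k hk]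

theorem IsHeckeFamily.span_mul_intervalAlgebra (ht : IsHeckeFamily q n t) {k : ℕ}
    (hk : k + 1 < n) :
    Submodule.span ℂ {t k} * (intervalAlgebra t 0 k).toSubmodule =
      (intervalAlgebra t 0 k).toSubmodule * Submodule.span ℂ {t k} := by
  refine Submodule.mul_comm_of_commute fun x hx y hy => ?_
  obtain ⟨c, rfl⟩ := Submodule.mem_span_singleton.1 hx
  exact ((ht.commute_apply hk hy).smul_right c).symm

/- The last generator is needed at most once: between two occurrences of it, the previous generator
occurs at most once by induction, and the quadratic or the braid relation removes one of the two. -/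
theorem IsHeckeFamily.toSubmodule_intervalAlgebra_le (hq : q ≠ 0) (ht : IsHeckeFamily q n t) :
    ∀ k, k + 2 ≤ n → (intervalAlgebra t 0 (k + 2)).toSubmodule ≤
      (intervalAlgebra t 0 (k + 1)).toSubmodule ⊔
        (intervalAlgebra t 0 (k + 1)).toSubmodule * Submodule.span ℂ {t k} *
          (intervalAlgebra t 0 (k + 1)).toSubmodule := by
  intro k hk
  refine le_trans (intervalAlgebra_le fun i _ hi => ?_)
    (toSubmodule_adjoin_union_le (T := Submodule.span ℂ {t k}) ?_)
  · refine Algebra.subset_adjoin ?_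
    rcases Nat.lt_succ_iff_lt_or_eq.1 (Nat.lt_of_succ_lt_succ hi) with h | rfl
    · exact Or.inl (mem_intervalAlgebra i.zero_le (by omega))
    · exact Or.inr (Submodule.mem_span_singleton_self _)
  · match k, hk with
    | 0, hk =>
      rw [intervalAlgebra_eq_bot (t := t) le_rfl, Algebra.toSubmodule_bot, mul_one, mul_one,
        one_mul]
      exact ht.span_mul_span_le hq hk
    | k + 1, hk =>
      exact mul_mul_le_of_braid (Subalgebra.isIdempotentElem_toSubmodule _)
        (Submodule.one_le.2 (one_mem (intervalAlgebra t 0 (k + 2))))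
        (intervalAlgebra_mono le_rfl (Nat.le_succ _))
        ((Submodule.span_singleton_le_iff_mem _ _).2
          (mem_intervalAlgebra k.zero_le k.succ.lt_succ_self))
        (ht.toSubmodule_intervalAlgebra_le hq k (by omega)) (ht.span_mul_intervalAlgebra hk)
        (ht.span_mul_span_le hq hk) (ht.span_mul_span_mul_span hk)

theorem IsHeckeFamily.map_mul_mul_descProd (ht : IsHeckeFamily q n t) {φ : A →ₗ[ℂ] V}
    (hφ : ∀ x, ∀ y ∈ intervalAlgebra t 0 n, φ (x * y) = φ (y * x)) {j m : ℕ} (hj : j + m + 2 = n)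
    {u v : A} (hu : u ∈ intervalAlgebra t 0 (j + 1)) (hv : v ∈ intervalAlgebra t 0 (j + 1)) :
    φ (u * t j * v * descProd t (j + 1) m) = φ (v * u * descProd t j (m + 1)) := by
  set d := descProd t (j + 1) m
  have hd : d ∈ intervalAlgebra t (j + 1) n := by
    have h := descProd_sub_smul_mem t 0 (j + 1) m
    rwa [zero_smul, sub_zero, show j + 1 + m + 1 = n by omega] at h
  have hvd : Commute v d := ht.commute le_rfl le_rfl hv hd
  have huvd : Commute (v * u) d := ht.commute le_rfl le_rfl (mul_mem hv hu) hd
  calc φ (u * t j * v * d) = φ (u * t j * d * v) := by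
        rw [mul_assoc _ v, hvd.eq, ← mul_assoc]
    _ = φ (v * u * t j * d) := by
        rw [hφ _ _ (intervalAlgebra_mono le_rfl (by omega) hv), ← mul_assoc, ← mul_assoc]
    _ = φ (v * u * d * t j) := by
        rw [hφ _ _ (intervalAlgebra_mono (Nat.zero_le _) le_rfl hd), ← mul_assoc, huvd.eq]
    _ = φ (v * u * descProd t j (m + 1)) := by rw [mul_assoc, ← descProd_succ']

theorem IsHeckeFamily.map_mem_of_cyclic (hq : q ≠ 0) (ht : IsHeckeFamily q n t) {φ : A →ₗ[ℂ] V}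
    (hφ : ∀ x, ∀ y ∈ intervalAlgebra t 0 n, φ (x * y) = φ (y * x)) {P : Submodule ℂ V}
    (hP : ∀ i < n, ∀ x ∈ intervalAlgebra t 0 i, φ (x * descProd t i (n - 1 - i)) ∈ P)
    (hn : 1 ≤ n) {z : A} (hz : z ∈ intervalAlgebra t 0 n) : φ z ∈ P := by
  have key : ∀ j < n, ∀ x ∈ intervalAlgebra t 0 (j + 1),
      φ (x * descProd t j (n - 1 - j)) ∈ P := by
    intro j
    induction j with
    | zero =>
      intro hj x hx
      refine hP 0 hj x ?_
      rwa [intervalAlgebra_eq_bot (Nat.zero_le _), ← intervalAlgebra_eq_bot (Nat.le_refl _)]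
    | succ j ih =>
      intro hj x hx
      obtain ⟨u, hu, w, hw, rfl⟩ :=
        Submodule.mem_sup.1 (ht.toSubmodule_intervalAlgebra_le hq j (by omega) hx)
      rw [add_mul, map_add]
      refine add_mem (hP _ hj u hu) ?_
      clear hx
      induction hw using Submodule.mul_induction_on' with
      | mem_mul_mem y hy v hv =>
        obtain ⟨u, hu, rfl⟩ := Submodule.mem_mul_span_singleton.1 hy
        rw [ht.map_mul_mul_descProd hφ (by omega) hu hv,
          show n - 1 - (j + 1) + 1 = n - 1 - j by omega]
        exact ih (by omega) _ (mul_mem hv hu)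
      | add x _ y _ hx hy =>
        rw [add_mul, map_add]
        exact add_mem hx hy
  have h := key (n - 1) (by omega) z (by rwa [Nat.sub_add_cancel hn])
  rwa [Nat.sub_self, descProd, mul_one] at h

end Spanning

/-! ### Multi-indices -/

section Snoc

variable {α : Type*} {N n : ℕ}

/-- The multi-index `x` with one more entry `a` at the end, the non-dependent `Fin.snoc`. It splits
the rows and columns of a matrix on `n + 1` tensor factors into the first `n` and the last one. -/
def snoc (x : Fin n → α) (a : α) : Fin (n + 1) → α :=
  Fin.snoc (α := fun _ => α) x a

@[simp] theorem snoc_castSucc (x : Fin n → α) (a : α) (i : Fin n) : snoc x a i.castSucc = x i :=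
  Fin.snoc_castSucc (α := fun _ => α) a x i

@[simp] theorem snoc_last (x : Fin n → α) (a : α) : snoc x a (Fin.last n) = a :=
  Fin.snoc_last (α := fun _ => α) a x

theorem snoc_comp_castSucc (x : Fin n → α) (a : α) : snoc x a ∘ Fin.castSucc = x :=
  funext (snoc_castSucc x a)

theorem exists_eq_snoc (z : Fin (n + 1) → α) : ∃ x a, z = snoc x a :=
  ⟨fun i => z i.castSucc, z (Fin.last n), (Fin.snoc_init_self z).symm⟩

theorem snoc_inj {x y : Fin n → α} {a b : α} : snoc x a = snoc y b ↔ x = y ∧ a = b :=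
  Fin.snoc_inj

theorem sum_snoc [Fintype α] {M : Type*} [AddCommMonoid M] (f : (Fin (n + 1) → α) → M) :
    ∑ z, f z = ∑ x : Fin n → α, ∑ a, f (snoc x a) := by
  rw [Finset.sum_comm, ← Fintype.sum_prod_type' (f := fun a x => f (snoc x a))]
  exact (Fintype.sum_equiv (Fin.snocEquiv fun _ : Fin (n + 1) => α) _ _ fun _ => rfl).symm

theorem matrix_ext_snoc {S : Type*} {M M' : Matrix (Fin (n + 1) → α) (Fin (n + 1) → α) S}
    (h : ∀ x a y b, M (snoc x a) (snoc y b) = M' (snoc x a) (snoc y b)) : M = M' := by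
  ext u v
  obtain ⟨x, a, rfl⟩ := exists_eq_snoc u
  obtain ⟨y, b, rfl⟩ := exists_eq_snoc v
  exact h x a y b

end Snoc

/-! ### Operators on tensor powers -/

/-- Matrices acting on the `n`-fold tensor power of `U ^ N`. -/
abbrev TensorEnd (U : Type*) (N n : ℕ) : Type _ := Matrix (Fin n → Fin N) (Fin n → Fin N) U

section TensorEnd

variable {N n r s : ℕ} {U : Type*} [Ring U] [Algebra ℂ U]

variable (U) in
/-- The passage from complex matrices to matrices over a complex algebra `U`. -/
def baseChange {ι : Type*} [Fintype ι] [DecidableEq ι] : Matrix ι ι ℂ →ₐ[ℂ] Matrix ι ι U :=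
  (Algebra.ofId ℂ U).mapMatrix

theorem baseChange_apply {ι : Type*} [Fintype ι] [DecidableEq ι] (A : Matrix ι ι ℂ) (i j : ι) :
    baseChange U A i j = algebraMap ℂ U (A i j) := rfl

theorem baseChange_mul_smul {ι : Type*} [Fintype ι] [DecidableEq ι] (A : Matrix ι ι ℂ) (u : U)
    (M : Matrix ι ι U) : baseChange U A * u • M = u • (baseChange U A * M) := by
  ext i j
  simp only [Matrix.mul_apply, Matrix.smul_apply, baseChange_apply, smul_eq_mul, Finset.mul_sum]
  exact Finset.sum_congr rfl fun k _ => (Algebra.left_comm _ _ _).symm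

/-- `place f` as a homomorphism of algebras. -/
def placeHom (f : Fin r ↪ Fin n) : TensorEnd U N r →ₐ[ℂ] TensorEnd U N n where
  toFun := place f
  map_one' := place_one f
  map_mul' := place_mul f f.injective
  map_zero' := by
    have h := place_smul f (0 : U) (0 : TensorEnd U N r)
    rwa [zero_smul, zero_smul] at h
  map_add' := place_add f
  commutes' c := by
    change place f _ = _
    rw [Algebra.algebraMap_eq_smul_one, Algebra.algebraMap_eq_smul_one,
      ← algebraMap_smul U c (1 : TensorEnd U N r), ← algebraMap_smul U c (1 : TensorEnd U N n),
      place_smul, place_one]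

theorem placeHom_apply (f : Fin r ↪ Fin n) (A : TensorEnd U N r) : placeHom f A = place f A := rfl

theorem placeHom_placeHom (f : Fin r ↪ Fin n) (g : Fin s ↪ Fin r) (A : TensorEnd U N s) :
    placeHom f (placeHom g A) = placeHom (g.trans f) A :=
  place_place f f.injective g A

theorem baseChange_place (f : Fin r → Fin n) (A : TensorEnd ℂ N r) :
    baseChange U (place f A) = place f (baseChange U A) := by
  ext x y
  by_cases h : ∀ j, j ∉ Set.range f → x j = y j
  · simp only [baseChange_apply, place_apply_pos f _ h]
  · simp only [baseChange_apply, place_apply_neg f _ h, map_zero]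

theorem place_commute_baseChange (f : Fin r ↪ Fin n) (g : Fin s → Fin n)
    (hfg : ∀ i j, f i ≠ g j) (A : TensorEnd U N r) (B : TensorEnd ℂ N s) :
    Commute (place f A) (baseChange U (place g B)) := by
  induction A using Matrix.induction_on' with
  | h_zero =>
    have h0 : place f (0 : TensorEnd U N r) = 0 := map_zero (placeHom f)
    rw [h0]
    exact Commute.zero_left _
  | h_add A A' hA hA' => rw [place_add]; exact hA.add_left hA'
  | h_std_basis i j u =>
    have hu : Matrix.single i j u = u • baseChange U (Matrix.single i j 1) := by
      ext k l
      simp only [Matrix.smul_apply, baseChange_apply, Matrix.single_apply, smul_eq_mul]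
      split_ifs <;> simp only [map_one, map_zero, mul_one, mul_zero]
    have hc : place f (Matrix.single i j (1 : ℂ)) * place g B = _ := place_comm f g hfg _ B
    rw [hu, place_smul, ← baseChange_place, Commute, SemiconjBy, smul_mul_assoc,
      baseChange_mul_smul, ← map_mul, hc, map_mul]

/-- `M ⊗ I`, with one more tensor factor. -/
def tensorOne : TensorEnd U N n →ₐ[ℂ] TensorEnd U N (n + 1) := placeHom Fin.castSuccEmb

theorem tensorOne_snoc (M : TensorEnd U N n) (x y : Fin n → Fin N) (a b : Fin N) :
    tensorOne M (snoc x a) (snoc y b) = if a = b then M x y else 0 := by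
  have key : (∀ j : Fin (n + 1), j ∉ Set.range Fin.castSucc → snoc x a j = snoc y b j) ↔ a = b := by
    simp only [Fin.range_castSucc, Set.mem_ofPred_eq, Fin.forall_fin_succ', Fin.val_castSucc,
      Fin.is_lt, not_true_eq_false, false_implies, implies_true, true_and, Fin.val_last,
      lt_self_iff_false, not_false_eq_true, forall_const, snoc_last]
  split_ifs with h
  · exact (place_apply_pos _ _ (key.2 h)).trans
      (congrArg₂ M (snoc_comp_castSucc x a) (snoc_comp_castSucc y b))
  · exact place_apply_neg _ _ fun h' => h (key.1 h')

theorem baseChange_tensorOne (M : TensorEnd ℂ N n) :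
    baseChange U (tensorOne M) = tensorOne (baseChange U M) :=
  baseChange_place _ M

theorem tensorOne_mul_apply (A : TensorEnd U N n) (M : TensorEnd U N (n + 1)) (x : Fin n → Fin N)
    (a : Fin N) (z : Fin (n + 1) → Fin N) :
    (tensorOne A * M) (snoc x a) z = ∑ w, A x w * M (snoc w a) z := by
  simp only [Matrix.mul_apply, sum_snoc, tensorOne_snoc, ite_mul, zero_mul, Finset.sum_ite_eq,
    Finset.mem_univ, if_true]

theorem mul_tensorOne_apply (A : TensorEnd U N n) (M : TensorEnd U N (n + 1)) (x : Fin n → Fin N)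
    (a : Fin N) (z : Fin (n + 1) → Fin N) :
    (M * tensorOne A) z (snoc x a) = ∑ w, M z (snoc w a) * A w x := by
  simp only [Matrix.mul_apply, sum_snoc, tensorOne_snoc, mul_ite, mul_zero, Finset.sum_ite_eq',
    Finset.mem_univ, if_true]

theorem tensorOne_smul_one (u : U) :
    tensorOne (u • (1 : TensorEnd U N n)) = u • 1 :=
  (place_smul _ u _).trans (by rw [place_one])

end TensorEnd

/-! ### Operators acting in adjacent tensor factors -/

section Sites

variable {N n : ℕ}

/-- `site2 n · k` as a homomorphism of monoids. It is not linear if `k + 1 ≥ n`, where all its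
values are `1`. -/
def site2Hom (n k : ℕ) : Matrix (Fin N × Fin N) (Fin N × Fin N) ℂ →* TensorEnd ℂ N n where
  toFun A := site2 n A k
  map_one' := by
    by_cases h : k + 1 < n
    · rw [site2, dif_pos h, pairMat_one, place_one]
    · rw [site2, dif_neg h]
  map_mul' A B := by
    by_cases h : k + 1 < n
    · have hf : Function.Injective fun i : Fin 2 => (⟨k + i, by omega⟩ : Fin n) := fun i j e =>
        Fin.ext (Nat.add_left_cancel (Fin.mk.inj e))
      simp only [site2, dif_pos h, pairMat_mul, place_mul _ hf]
    · simp only [site2, dif_neg h, mul_one]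

theorem site2_snoc (R : Matrix (Fin N × Fin N) (Fin N × Fin N) ℂ) (x y : Fin n → Fin N)
    (i b p r : Fin N) :
    site2 (n + 2) R n (snoc (snoc x i) b) (snoc (snoc y p) r) =
      if x = y then R (i, b) (p, r) else 0 := by
  have hn : (⟨n, by omega⟩ : Fin (n + 2)) = (Fin.last n).castSucc := rfl
  have hn' : (⟨n + 1, by omega⟩ : Fin (n + 2)) = Fin.last (n + 1) := rfl
  have key : (∀ j : Fin (n + 2), j ∉ Set.range (fun i : Fin 2 => (⟨n + i, by omega⟩ : Fin (n + 2)))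
      → snoc (snoc x i) b j = snoc (snoc y p) r j) ↔ x = y := by
    have hr : ∀ j : Fin n, j.castSucc.castSucc ∉
        Set.range fun i : Fin 2 => (⟨n + i, by omega⟩ : Fin (n + 2)) := by
      rintro j ⟨k, hk⟩
      have := congrArg Fin.val hk
      simp only [Fin.val_castSucc] at this
      omega
    simp only [Fin.forall_fin_succ', snoc_castSucc, snoc_last, hr, not_false_eq_true, forall_const]
    refine ⟨fun h => funext h.1.1, fun h => ⟨⟨congrFun h, ?_⟩, ?_⟩⟩
    · exact fun h' => absurd ⟨0, hn⟩ h'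
    · exact fun h' => absurd ⟨1, hn'⟩ h'
  rw [site2, dif_pos (by omega)]
  split_ifs with h
  · rw [place_apply_pos _ _ (key.2 h)]
    simp only [pairMat, Matrix.of_apply, Function.comp_apply, Fin.val_zero, Fin.val_one, add_zero,
      hn, hn', snoc_castSucc, snoc_last]
  · exact place_apply_neg _ _ fun h' => h (key.1 h')

variable {U : Type*} [Ring U] [Algebra ℂ U]

theorem site2_mul_apply (R : Matrix (Fin N × Fin N) (Fin N × Fin N) ℂ)
    (M : TensorEnd U N (n + 2)) (x : Fin n → Fin N) (i b : Fin N) (z : Fin (n + 2) → Fin N) :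
    (baseChange U (site2 (n + 2) R n) * M) (snoc (snoc x i) b) z =
      ∑ p, ∑ r, R (i, b) (p, r) • M (snoc (snoc x p) r) z := by
  simp only [Matrix.mul_apply, sum_snoc, baseChange_apply, site2_snoc, ← Algebra.smul_def,
    ite_smul, zero_smul]
  rw [Fintype.sum_eq_single x fun y hy => by simp only [hy.symm, if_false, Finset.sum_const_zero]]
  simp only [if_true]

theorem mul_site2_apply (R : Matrix (Fin N × Fin N) (Fin N × Fin N) ℂ)
    (M : TensorEnd U N (n + 2)) (x : Fin n → Fin N) (i b : Fin N) (z : Fin (n + 2) → Fin N) :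
    (M * baseChange U (site2 (n + 2) R n)) z (snoc (snoc x i) b) =
      ∑ p, ∑ r, R (p, r) (i, b) • M z (snoc (snoc x p) r) := by
  simp only [Matrix.mul_apply, sum_snoc, baseChange_apply, site2_snoc, ← Algebra.commutes,
    ← Algebra.smul_def, ite_smul, zero_smul]
  rw [Fintype.sum_eq_single x fun y hy => by simp only [hy, if_false, Finset.sum_const_zero]]
  simp only [if_true]

theorem placeHom_castLE_site2 (A : Matrix (Fin N × Fin N) (Fin N × Fin N) ℂ) {j k : ℕ}
    (hj : j ≤ n) (h : k + 1 < j) : placeHom (Fin.castLEEmb hj) (site2 j A k) = site2 n A k := by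
  rw [placeHom_apply, site2, site2, dif_pos h, dif_pos (by omega),
    place_place _ (Fin.castLEEmb hj).injective]
  rfl

theorem tensorOne_site2 (A : Matrix (Fin N × Fin N) (Fin N × Fin N) ℂ) {k : ℕ} (h : k + 1 < n) :
    tensorOne (site2 n A k) = site2 (n + 1) A k :=
  placeHom_castLE_site2 A n.le_succ h

theorem placeHom_castLE_site1 (M : Matrix (Fin N) (Fin N) U) {j : ℕ} (hj : j ≤ n) (h : 0 < j) :
    placeHom (Fin.castLEEmb hj) (site1 j M) = site1 n M := by
  rw [placeHom_apply, site1, site1, dif_pos h, dif_pos (by omega),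
    place_place _ (Fin.castLEEmb hj).injective]
  rfl

theorem tensorOne_site1 (M : Matrix (Fin N) (Fin N) U) (h : 0 < n) :
    tensorOne (site1 n M) = site1 (n + 1) M :=
  placeHom_castLE_site1 M n.le_succ h

theorem site1_commute_site2 (M : Matrix (Fin N) (Fin N) U)
    (A : Matrix (Fin N × Fin N) (Fin N × Fin N) ℂ) (n k : ℕ) :
    Commute (site1 n M) (baseChange U (site2 n A (k + 1))) := by
  by_cases hk : k + 1 + 1 < n
  · simp only [site1, site2, dif_pos hk, dif_pos (show 0 < n by omega)]
    refine place_commute_baseChange ⟨_, Function.injective_of_subsingleton _⟩ _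
      (fun i j e => ?_) _ _
    simp only [Function.Embedding.coeFn_mk, Fin.mk.injEq] at e
    omega
  · simp only [site2, dif_neg hk, map_one, Commute.one_right]

theorem tensorOne_tensorOne_commute_site2 (A : TensorEnd U N n)
    (B : Matrix (Fin N × Fin N) (Fin N × Fin N) ℂ) :
    Commute (tensorOne (tensorOne A)) (baseChange U (site2 (n + 2) B n)) := by
  rw [tensorOne, tensorOne, placeHom_placeHom, site2, dif_pos (by omega)]
  refine place_commute_baseChange _ _ (fun i j e => ?_) _ _
  have := congrArg Fin.val e
  simp only [Function.Embedding.trans_apply, Fin.coe_castSuccEmb, Fin.val_castSucc] at this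
  omega

end Sites

/-! ### Partial traces -/

section PartialTrace

variable {N n : ℕ} {U : Type*} [Ring U] [Algebra ℂ U] (C : Matrix (Fin N) (Fin N) ℂ)

theorem sum_rotate {ι κ μ M : Type*} [Fintype ι] [Fintype κ] [Fintype μ] [AddCommMonoid M]
    (f : ι → κ → μ → M) : ∑ a, ∑ b, ∑ c, f a b c = ∑ c, ∑ a, ∑ b, f a b c := by
  rw [Finset.sum_congr rfl fun a _ => Finset.sum_comm, Finset.sum_comm]

/-- The tensor power `C₁ C₂ ⋯ C_n`, whose trace against `M` is `rTrace C n M`. -/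
def tensorPow (n : ℕ) : TensorEnd ℂ N n :=
  Matrix.of fun x y => ∏ i, C (x i) (y i)

theorem tensorPow_snoc (x y : Fin n → Fin N) (a b : Fin N) :
    tensorPow C (n + 1) (snoc x a) (snoc y b) = tensorPow C n x y * C a b := by
  simp only [tensorPow, Matrix.of_apply, Fin.prod_univ_castSucc, snoc_castSucc, snoc_last]

/-- The partial trace `Tr (C M)` over the last tensor factor. -/
def partialTrace (M : TensorEnd U N (n + 1)) : TensorEnd U N n :=
  Matrix.of fun x y => ∑ a, ∑ b, C a b • M (snoc x b) (snoc y a)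

theorem partialTrace_apply (M : TensorEnd U N (n + 1)) (x y : Fin n → Fin N) :
    partialTrace C M x y = ∑ a, ∑ b, C a b • M (snoc x b) (snoc y a) := rfl

theorem rTrace_eq_sum (M : TensorEnd U N n) :
    rTrace C n M = ∑ x, ∑ y, tensorPow C n x y • M y x := by
  simp only [rTrace, tensorPow, Matrix.trace, Matrix.diag, Matrix.mul_apply, Algebra.smul_def,
    Matrix.of_apply]

theorem rTrace_succ (M : TensorEnd U N (n + 1)) :
    rTrace C (n + 1) M = rTrace C n (partialTrace C M) := by
  simp only [rTrace_eq_sum, sum_snoc, partialTrace_apply, tensorPow_snoc, Finset.smul_sum,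
    smul_smul]
  exact Finset.sum_congr rfl fun x _ => Finset.sum_comm

theorem eq_rTrace_smul_one (M : TensorEnd U N 0) : M = rTrace C 0 M • 1 := by
  ext x y
  simp only [rTrace_eq_sum, tensorPow, Matrix.of_apply, Finset.univ_eq_empty, Finset.prod_empty,
    one_smul, Fintype.sum_unique, Subsingleton.elim _ x, Matrix.smul_apply, Matrix.one_apply_eq,
    smul_eq_mul, mul_one]

theorem partialTrace_tensorOne_mul (A : TensorEnd U N n) (M : TensorEnd U N (n + 1)) :
    partialTrace C (tensorOne A * M) = A * partialTrace C M := by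
  ext x y
  rw [Matrix.mul_apply]
  simp only [partialTrace_apply, tensorOne_mul_apply, Finset.smul_sum,
    Finset.mul_sum, mul_smul_comm]
  exact sum_rotate _

theorem partialTrace_mul_tensorOne (A : TensorEnd U N n) (M : TensorEnd U N (n + 1)) :
    partialTrace C (M * tensorOne A) = partialTrace C M * A := by
  ext x y
  rw [Matrix.mul_apply]
  simp only [partialTrace_apply, mul_tensorOne_apply, Finset.smul_sum,
    Finset.sum_mul, smul_mul_assoc]
  exact sum_rotate _

/-- The coefficients of `Y` in the partial trace `Tr (C₃ A₂₃ Y₁₂ B₂₃)` over the third factor;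
see `partialTrace_sandwich`. -/
def sandwich (A B : Matrix (Fin N × Fin N) (Fin N × Fin N) ℂ) (i j p p' : Fin N) : ℂ :=
  ∑ a, ∑ b, ∑ c, C a b * A (i, b) (p, c) * B (p', c) (j, a)

theorem partialTrace_sandwich (A B : Matrix (Fin N × Fin N) (Fin N × Fin N) ℂ)
    (Y : TensorEnd U N (n + 1)) (x y : Fin n → Fin N) (i j : Fin N) :
    partialTrace C (baseChange U (site2 (n + 2) A n) * tensorOne Y *
        baseChange U (site2 (n + 2) B n)) (snoc x i) (snoc y j) =
      ∑ p, ∑ p', sandwich C A B i j p p' • Y (snoc x p) (snoc y p') := by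
  have entry (a b : Fin N) : (baseChange U (site2 (n + 2) A n) * tensorOne Y *
      baseChange U (site2 (n + 2) B n)) (snoc (snoc x i) b) (snoc (snoc y j) a) =
      ∑ p, ∑ p', ∑ c, (A (i, b) (p, c) * B (p', c) (j, a)) • Y (snoc x p) (snoc y p') := by
    simp only [mul_site2_apply, site2_mul_apply, tensorOne_snoc, smul_ite, smul_zero,
      Finset.sum_ite_eq', Finset.mem_univ, if_true, Finset.smul_sum, smul_smul]
    rw [sum_rotate]
    simp only [mul_comm]
  simp only [partialTrace_apply, entry, Finset.smul_sum, sandwich, Finset.sum_smul, smul_smul,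
    ← mul_assoc]
  rw [Finset.sum_congr rfl fun a _ => (sum_rotate _).symm, ← sum_rotate]

theorem rTrace_mul_comm {Z : TensorEnd ℂ N n} (h : Commute (tensorPow C n) Z)
    (M : TensorEnd U N n) :
    rTrace C n (baseChange U Z * M) = rTrace C n (M * baseChange U Z) := by
  change (baseChange U (tensorPow C n) * _).trace = (baseChange U (tensorPow C n) * _).trace
  rw [← mul_assoc, ← mul_assoc, ← map_mul, h.eq, map_mul, mul_assoc]
  generalize baseChange U (tensorPow C n) * M = M'
  simp only [Matrix.trace, Matrix.diag, Matrix.mul_apply]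
  rw [Finset.sum_comm]
  exact Finset.sum_congr rfl fun _ _ => Finset.sum_congr rfl fun _ _ => Algebra.commutes _ _

theorem tensorPow_commute_tensorOne {Z : TensorEnd ℂ N n} (h : Commute (tensorPow C n) Z) :
    Commute (tensorPow C (n + 1)) (tensorOne Z) := by
  refine matrix_ext_snoc fun x a y b => ?_
  have entry := congrFun (congrFun h.eq x) y
  simp only [Matrix.mul_apply] at entry
  rw [tensorOne_mul_apply, mul_tensorOne_apply]
  simp only [tensorPow_snoc, ← mul_assoc, ← Finset.sum_mul, ← entry]
  simp only [Finset.sum_mul, mul_right_comm]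

end PartialTrace

/-! ### The matrix `C` -/

section CMatrix

variable {N n : ℕ} {q : ℂ} {R Ψ : Matrix (Fin N × Fin N) (Fin N × Fin N) ℂ}

theorem braid_conj {G : Type*} [Group G] {a b : G} (h : a * b * a = b * a * b) :
    b * a * b⁻¹ = a⁻¹ * b * a := by
  rw [mul_inv_eq_iff_eq_mul, mul_assoc, mul_assoc, eq_inv_mul_iff_mul_eq, ← mul_assoc, ← mul_assoc,
    h]

/-- A Hecke symmetry as a unit, with inverse `R⁻¹`. -/
def IsHeckeSymmetry.unit (hR : IsHeckeSymmetry q R) :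
    (Matrix (Fin N × Fin N) (Fin N × Fin N) ℂ)ˣ :=
  have h : R * R⁻¹ = 1 := by
    have h' := mul_sub_eq_one_of_hecke hR.ne_zero R hR.hecke
    rwa [Matrix.inv_eq_right_inv h']
  ⟨R, R⁻¹, h, mul_eq_one_comm.1 h⟩

/-- The operator `R_k` as a unit, with inverse `site2 n R⁻¹ k`. -/
def siteUnit (hR : IsHeckeSymmetry q R) (n k : ℕ) : (TensorEnd ℂ N n)ˣ :=
  Units.map (site2Hom n k) hR.unit

theorem siteUnit_braid (hR : IsHeckeSymmetry q R) {k : ℕ} (h : k + 2 < n) :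
    siteUnit hR n k * siteUnit hR n (k + 1) * siteUnit hR n k =
      siteUnit hR n (k + 1) * siteUnit hR n k * siteUnit hR n (k + 1) :=
  Units.ext (site2_braid hR n k h)

theorem midTrace_self_apply (R Ψ : Matrix (Fin N × Fin N) (Fin N × Fin N) ℂ) (i j : Fin N) :
    ∑ e, midTrace R Ψ (i, e) (j, e) = ∑ a, ∑ b, cMat Ψ a b * R (i, b) (j, a) := by
  simp only [midTrace, cMat, Matrix.of_apply, Finset.sum_mul]
  rw [← sum_rotate, Finset.sum_comm]
  refine Finset.sum_congr rfl fun _ _ => Finset.sum_congr rfl fun _ _ =>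
    Finset.sum_congr rfl fun _ _ => mul_comm _ _

theorem partialTrace_site2 (hΨ : IsSkewInverse R Ψ) (n : ℕ) :
    partialTrace (cMat Ψ) (site2 (n + 2) R n) = 1 := by
  have trace_flip (i j : Fin N) : ∑ e, flip N (i, e) (j, e) = if i = j then 1 else 0 := by
    simp only [flip, Matrix.of_apply, ite_and, Finset.sum_ite_eq, Finset.mem_univ, if_true]
  refine matrix_ext_snoc fun x i y j => ?_
  simp only [partialTrace_apply, site2_snoc, Matrix.one_apply, snoc_inj, ite_and, smul_eq_mul]
  by_cases hxy : x = y
  · simp only [if_pos hxy, ← midTrace_self_apply, hΨ.left, trace_flip]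
  · simp only [if_neg hxy, mul_zero, Finset.sum_const_zero]

theorem IsSkewInverse.sum_mul_sum (hΨ : IsSkewInverse R Ψ) (f : Fin N → Fin N → ℂ)
    (x y : Fin N) :
    ∑ b, ∑ c, Ψ (y, b) (x, c) * ∑ p, ∑ p', R (c, p) (b, p') * f p p' = f x y := by
  calc ∑ b, ∑ c, Ψ (y, b) (x, c) * ∑ p, ∑ p', R (c, p) (b, p') * f p p'
      = ∑ p, ∑ p', midTrace Ψ R (y, p) (x, p') * f p p' := by
        simp only [midTrace, Matrix.of_apply, Finset.mul_sum, Finset.sum_mul, ← mul_assoc]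
        rw [Finset.sum_congr rfl fun b _ => (sum_rotate _).symm, ← sum_rotate]
    _ = f x y := by
        simp only [hΨ.right, flip, Matrix.of_apply, ite_and, ite_mul, one_mul, zero_mul,
          Finset.sum_ite_eq, Finset.mem_univ, if_true, Finset.sum_ite_eq']

theorem sandwich_eq_of_partialTrace (hΨ : IsSkewInverse R Ψ)
    (A B : Matrix (Fin N × Fin N) (Fin N × Fin N) ℂ)
    (h : partialTrace (cMat Ψ) (site2 3 A 1 * tensorOne (site2 2 R 0) * site2 3 B 1) = 1)
    (i j x y : Fin N) :
    sandwich (cMat Ψ) A B i j x y = if i = j then cMat Ψ y x else 0 := by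
  have inner (b c : Fin N) : ∑ p, ∑ p', R (c, p) (b, p') * sandwich (cMat Ψ) A B i j p p' =
      if c = b ∧ i = j then 1 else 0 := by
    let z : Fin 0 → Fin N := Fin.elim0
    have entry := (partialTrace_sandwich (U := ℂ) (cMat Ψ) A B (site2 2 R 0) (snoc z c) (snoc z b)
      i j).symm.trans (congrFun (congrFun h (snoc (snoc z c) i)) (snoc (snoc z b) j))
    simpa only [Matrix.one_apply, snoc_inj, true_and, site2_snoc, if_true, smul_eq_mul,
      mul_comm (sandwich _ _ _ _ _ _ _)] using entry
  rw [← hΨ.sum_mul_sum (sandwich (cMat Ψ) A B i j)]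
  simp only [inner]
  by_cases hij : i = j <;> simp [hij, cMat]

theorem sandwich_inv (hR : IsHeckeSymmetry q R) (hΨ : IsSkewInverse R Ψ) (i j x y : Fin N) :
    sandwich (cMat Ψ) R R⁻¹ i j x y = if i = j then cMat Ψ y x else 0 := by
  refine sandwich_eq_of_partialTrace hΨ _ _ ?_ i j x y
  have conj : site2 3 R 1 * site2 3 R 0 * site2 3 R⁻¹ 1 =
      site2 3 R⁻¹ 0 * site2 3 R 1 * site2 3 R 0 :=
    congrArg Units.val (braid_conj (siteUnit_braid hR (n := 3) (k := 0) (by omega)))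
  rw [tensorOne_site2 _ (by omega), conj, ← tensorOne_site2 R⁻¹ (show 0 + 1 < 2 by omega),
    ← tensorOne_site2 R (show 0 + 1 < 2 by omega), partialTrace_mul_tensorOne,
    partialTrace_tensorOne_mul, partialTrace_site2 hΨ 1, mul_one]
  exact (siteUnit hR 2 0).inv_mul

theorem inv_sandwich (hR : IsHeckeSymmetry q R) (hΨ : IsSkewInverse R Ψ) (i j x y : Fin N) :
    sandwich (cMat Ψ) R⁻¹ R i j x y = if i = j then cMat Ψ y x else 0 := by
  refine sandwich_eq_of_partialTrace hΨ _ _ ?_ i j x y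
  have conj : site2 3 R⁻¹ 1 * site2 3 R 0 * site2 3 R 1 =
      site2 3 R 0 * site2 3 R 1 * site2 3 R⁻¹ 0 :=
    congrArg Units.val (braid_conj (siteUnit_braid hR (n := 3) (k := 0) (by omega)).symm).symm
  rw [tensorOne_site2 _ (by omega), conj, ← tensorOne_site2 R⁻¹ (show 0 + 1 < 2 by omega),
    ← tensorOne_site2 R (show 0 + 1 < 2 by omega), partialTrace_mul_tensorOne,
    partialTrace_tensorOne_mul, partialTrace_site2 hΨ 1, mul_one]
  exact (siteUnit hR 2 0).mul_inv

theorem partialTrace_conj {U : Type*} [Ring U] [Algebra ℂ U] (hR : IsHeckeSymmetry q R)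
    (hΨ : IsSkewInverse R Ψ) (Y : TensorEnd U N (n + 1)) :
    partialTrace (cMat Ψ) (baseChange U (site2 (n + 2) R n) * tensorOne Y *
      baseChange U (site2 (n + 2) R⁻¹ n)) = tensorOne (partialTrace (cMat Ψ) Y) := by
  refine matrix_ext_snoc fun x i y j => ?_
  rw [partialTrace_sandwich, tensorOne_snoc, partialTrace_apply, Finset.sum_comm]
  simp only [sandwich_inv hR hΨ]
  split_ifs
  · rfl
  · simp only [zero_smul, Finset.sum_const_zero]

theorem inv_mul_cMat (hR : IsHeckeSymmetry q R) (hΨ : IsSkewInverse R Ψ) (y s j t : Fin N) :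
    ∑ a, cMat Ψ a t * R⁻¹ (y, s) (j, a) = ∑ x, Ψ (s, x) (t, j) * cMat Ψ y x := by
  rw [← hΨ.sum_mul_sum fun p p' => ∑ a, cMat Ψ a p * R⁻¹ (y, p') (j, a)]
  have inner (b c : Fin N) :
      ∑ p, ∑ p', R (c, p) (b, p') * ∑ a, cMat Ψ a p * R⁻¹ (y, p') (j, a) =
        sandwich (cMat Ψ) R R⁻¹ c j b y := by
    simp only [sandwich, Finset.mul_sum]
    rw [sum_rotate]
    simp only [mul_assoc, mul_left_comm]
  simp only [inner, sandwich_inv hR hΨ, mul_ite, mul_zero, Finset.sum_ite_eq', Finset.mem_univ,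
    if_true]

theorem cMat_mul_inv (hR : IsHeckeSymmetry q R) (hΨ : IsSkewInverse R Ψ) (i s x t : Fin N) :
    ∑ b, cMat Ψ s b * R⁻¹ (i, b) (x, t) = ∑ y, Ψ (s, i) (t, y) * cMat Ψ y x := by
  rw [← hΨ.sum_mul_sum fun p p' => ∑ b, cMat Ψ p' b * R⁻¹ (i, b) (x, p)]
  have inner (a c : Fin N) :
      ∑ p, ∑ p', R (c, p) (a, p') * ∑ b, cMat Ψ p' b * R⁻¹ (i, b) (x, p) =
        sandwich (cMat Ψ) R⁻¹ R i a x c := by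
    simp only [sandwich, Finset.mul_sum]
    rw [← sum_rotate]
    simp only [mul_comm]
  simp only [inner, inv_sandwich hR hΨ]
  rw [Finset.sum_comm]
  simp only [mul_ite, mul_zero, Finset.sum_ite_eq, Finset.mem_univ, if_true]

theorem kronecker_cMat_commute (hR : IsHeckeSymmetry q R) (hΨ : IsSkewInverse R Ψ) :
    Commute (cMat Ψ ⊗ₖ cMat Ψ) R := by
  suffices h : Commute (cMat Ψ ⊗ₖ cMat Ψ) ↑(hR.unit⁻¹) from (Commute.units_inv_right_iff.1 h :)
  ext ⟨i, s⟩ ⟨x, t⟩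
  change ((cMat Ψ ⊗ₖ cMat Ψ) * R⁻¹) (i, s) (x, t) = (R⁻¹ * (cMat Ψ ⊗ₖ cMat Ψ)) (i, s) (x, t)
  simp only [Matrix.mul_apply, Matrix.kroneckerMap_apply, Fintype.sum_prod_type]
  calc ∑ j, ∑ b, cMat Ψ i j * cMat Ψ s b * R⁻¹ (j, b) (x, t)
      = ∑ j, cMat Ψ i j * ∑ y, Ψ (s, j) (t, y) * cMat Ψ y x := by
        simp only [← cMat_mul_inv hR hΨ, Finset.mul_sum, mul_assoc]
    _ = ∑ y, (∑ j, Ψ (s, j) (t, y) * cMat Ψ i j) * cMat Ψ y x := by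
        simp only [Finset.mul_sum, Finset.sum_mul]
        rw [Finset.sum_comm]
        simp only [mul_left_comm, mul_assoc]
    _ = ∑ y, ∑ a, R⁻¹ (i, s) (y, a) * (cMat Ψ y x * cMat Ψ a t) := by
        simp only [← inv_mul_cMat hR hΨ, Finset.sum_mul]
        simp only [mul_left_comm, mul_comm]

theorem tensorPow_commute_site2 (hR : IsHeckeSymmetry q R) (hΨ : IsSkewInverse R Ψ) (n k : ℕ) :
    Commute (tensorPow (cMat Ψ) n) (site2 n R k) := by
  induction n with
  | zero => exact Commute.one_right _
  | succ n ih =>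
    rcases lt_trichotomy (k + 1) n with h | rfl | h
    · rw [← tensorOne_site2 R h]
      exact tensorPow_commute_tensorOne _ ih
    · refine matrix_ext_snoc fun u b v r => ?_
      obtain ⟨x, i, rfl⟩ := exists_eq_snoc u
      obtain ⟨y, p, rfl⟩ := exists_eq_snoc v
      have entry := congrFun (congrFun (kronecker_cMat_commute hR hΨ).eq (i, b)) (p, r)
      simp only [Matrix.mul_apply, Matrix.kroneckerMap_apply, Fintype.sum_prod_type] at entry
      have hl := mul_site2_apply R (tensorPow (cMat Ψ) (k + 2)) y p r (snoc (snoc x i) b)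
      have hr := site2_mul_apply R (tensorPow (cMat Ψ) (k + 2)) x i b (snoc (snoc y p) r)
      refine hl.trans (Eq.trans ?_ hr.symm)
      simp only [tensorPow_snoc, smul_eq_mul]
      calc _ = tensorPow (cMat Ψ) k x y *
            ∑ j, ∑ c, cMat Ψ i j * cMat Ψ b c * R (j, c) (p, r) := by
            simp only [Finset.mul_sum, mul_assoc, mul_comm (R _ _)]
        _ = _ := by
            rw [entry]
            simp only [Finset.mul_sum, mul_assoc, mul_left_comm]
    · rw [site2, dif_neg (by omega)]
      exact Commute.one_right _

end CMatrix

/-! ### The braided shift -/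

section Shift

variable {N n : ℕ} {q : ℂ} {R Ψ : Matrix (Fin N × Fin N) (Fin N × Fin N) ℂ}
  {U : Type*} [Ring U] [Algebra ℂ U]

/-- The product `R₁ R₂ ⋯ R_n` on `n + 1` tensor factors, which conjugates `R_k` to `R_{k+1}`. -/
def coxeterElt (hR : IsHeckeSymmetry q R) : (n : ℕ) → (TensorEnd ℂ N (n + 1))ˣ
  | 0 => 1
  | n + 1 => Units.map tensorOne.toMonoidHom (coxeterElt hR n) * siteUnit hR (n + 2) n

theorem val_coxeterElt_succ (hR : IsHeckeSymmetry q R) (n : ℕ) :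
    (coxeterElt hR (n + 1) : TensorEnd ℂ N (n + 2)) =
      tensorOne ↑(coxeterElt hR n) * site2 (n + 2) R n := rfl

theorem val_inv_coxeterElt_succ (hR : IsHeckeSymmetry q R) (n : ℕ) :
    (↑(coxeterElt hR (n + 1))⁻¹ : TensorEnd ℂ N (n + 2)) =
      site2 (n + 2) R⁻¹ n * tensorOne ↑(coxeterElt hR n)⁻¹ := by
  rw [coxeterElt, mul_inv_rev, ← map_inv]
  rfl

/-- An operator in the tensor factors `1, …, n` moved to the factors `2, …, n + 1` by means of the
braiding `R`. -/
def shift (hR : IsHeckeSymmetry q R) (n : ℕ) : TensorEnd U N n →ₐ[ℂ] TensorEnd U N (n + 1) :=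
  (MulSemiringAction.toAlgHom ℂ _
    (ConjAct.toConjAct (Units.map (baseChange U).toMonoidHom (coxeterElt hR n)))).comp tensorOne

theorem shift_apply (hR : IsHeckeSymmetry q R) (M : TensorEnd U N n) :
    shift hR n M = baseChange U (coxeterElt hR n : TensorEnd ℂ N (n + 1)) * tensorOne M *
      baseChange U ↑(coxeterElt hR n)⁻¹ := rfl

theorem shift_eq_of_semiconjBy (hR : IsHeckeSymmetry q R) {M : TensorEnd U N n}
    {M' : TensorEnd U N (n + 1)}
    (h : SemiconjBy (baseChange U (coxeterElt hR n : TensorEnd ℂ N (n + 1))) (tensorOne M) M') :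
    shift hR n M = M' := by
  rw [shift_apply, h.eq, mul_assoc, ← map_mul, Units.mul_inv, map_one, mul_one]

theorem baseChange_shift (hR : IsHeckeSymmetry q R) (Z : TensorEnd ℂ N n) :
    baseChange U (shift hR n Z) = shift hR n (baseChange U Z) := by
  rw [shift_apply, shift_apply, map_mul, map_mul, baseChange_tensorOne]
  rfl

theorem shift_tensorOne (hR : IsHeckeSymmetry q R) (M : TensorEnd U N n) :
    shift hR (n + 1) (tensorOne M) = tensorOne (shift hR n M) := by
  refine shift_eq_of_semiconjBy hR ?_
  rw [val_coxeterElt_succ, map_mul, baseChange_tensorOne]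
  refine SemiconjBy.mul_left ?_ (tensorOne_tensorOne_commute_site2 M R).symm
  rw [SemiconjBy, ← map_mul, ← map_mul, shift_apply, mul_assoc _ _ (baseChange U _), ← map_mul,
    Units.inv_mul, map_one, mul_one]

theorem shift_site2 (hR : IsHeckeSymmetry q R) {k : ℕ} (h : k + 1 < n) :
    shift hR n (site2 n R k) = site2 (n + 1) R (k + 1) := by
  induction n with
  | zero => omega
  | succ n ih =>
    rcases Nat.lt_or_ge (k + 1) n with hk | hk
    · rw [← tensorOne_site2 R hk, shift_tensorOne, ih hk, tensorOne_site2 R (by omega)]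
    · obtain rfl : n = k + 1 := by omega
      refine shift_eq_of_semiconjBy hR ?_
      change SemiconjBy (↑(coxeterElt hR (k + 2)) : TensorEnd ℂ N (k + 3)) _ _
      rw [val_coxeterElt_succ, val_coxeterElt_succ, map_mul, tensorOne_site2 R (by omega),
        mul_assoc]
      exact (tensorOne_tensorOne_commute_site2 _ R).semiconjBy.mul_left
        ((site2_braid hR (k + 3) k (by omega)).trans (mul_assoc _ _ _))

theorem shift_site1 (hR : IsHeckeSymmetry q R) (M : Matrix (Fin N) (Fin N) U) (hn : 0 < n) :
    shift hR n (site1 n M) = baseChange U (site2 (n + 1) R 0) * site1 (n + 1) M *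
      baseChange U (site2 (n + 1) R⁻¹ 0) := by
  induction n, hn using Nat.le_induction with
  | base =>
    rw [Nat.succ_eq_add_one, shift_apply, tensorOne_site1 M (by omega), val_coxeterElt_succ,
      val_inv_coxeterElt_succ]
    simp only [coxeterElt, Units.val_one, inv_one, map_one, one_mul, mul_one]
  | succ n hn ih =>
    rw [← tensorOne_site1 M hn, shift_tensorOne, ih, map_mul, map_mul, ← baseChange_tensorOne,
      ← baseChange_tensorOne, tensorOne_site2 R (by omega), tensorOne_site2 R⁻¹ (by omega),
      tensorOne_site1 M n.succ_pos]

theorem shift_smul_one (hR : IsHeckeSymmetry q R) (u : U) :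
    shift hR n (u • (1 : TensorEnd U N n)) = u • 1 := by
  refine shift_eq_of_semiconjBy hR ?_
  rw [tensorOne_smul_one, SemiconjBy, baseChange_mul_smul, mul_one, smul_mul_assoc, one_mul]

theorem partialTrace_shift (hR : IsHeckeSymmetry q R) (hΨ : IsSkewInverse R Ψ)
    (M : TensorEnd U N (n + 1)) :
    partialTrace (cMat Ψ) (shift hR (n + 1) M) = shift hR n (partialTrace (cMat Ψ) M) := by
  rw [shift_apply, shift_apply, val_coxeterElt_succ, val_inv_coxeterElt_succ, map_mul, map_mul,
    baseChange_tensorOne, baseChange_tensorOne, ← partialTrace_conj hR hΨ M,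
    ← partialTrace_tensorOne_mul, ← partialTrace_mul_tensorOne]
  simp only [mul_assoc]

/-- The `j`-fold iteration of `shift`. -/
def shiftN (hR : IsHeckeSymmetry q R) (n : ℕ) :
    (j : ℕ) → TensorEnd U N n →ₐ[ℂ] TensorEnd U N (n + j)
  | 0 => AlgHom.id ℂ _
  | j + 1 => (shift hR (n + j)).comp (shiftN hR n j)

theorem shiftN_succ (hR : IsHeckeSymmetry q R) (j : ℕ) (M : TensorEnd U N n) :
    shiftN hR n (j + 1) M = shift hR (n + j) (shiftN hR n j M) := rfl

theorem baseChange_shiftN (hR : IsHeckeSymmetry q R) (Z : TensorEnd ℂ N n) (j : ℕ) :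
    baseChange U (shiftN hR n j Z) = shiftN hR n j (baseChange U Z) := by
  induction j with
  | zero => rfl
  | succ j ih => exact (baseChange_shift hR _).trans (congrArg _ ih)

theorem shiftN_site2 (hR : IsHeckeSymmetry q R) {k : ℕ} (h : k + 1 < n) (j : ℕ) :
    shiftN hR n j (site2 n R k) = site2 (n + j) R (k + j) := by
  induction j with
  | zero => rfl
  | succ j ih => rw [shiftN_succ, ih, shift_site2 hR (by omega)]; rfl

/-- `TracesTo C j u n M`: the partial trace of `M` over the tensor factors `j + 1, …, n` is `u • I`.
An inductive predicate avoids transporting matrices along equalities of `n` and `j + (n - j)`. -/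
inductive TracesTo (C : Matrix (Fin N) (Fin N) ℂ) (j : ℕ) (u : U) :
    (n : ℕ) → TensorEnd U N n → Prop
  | base : TracesTo C j u j (u • 1)
  | step (n : ℕ) (M : TensorEnd U N (n + 1)) :
      TracesTo C j u n (partialTrace C M) → TracesTo C j u (n + 1) M

theorem TracesTo.shift (hR : IsHeckeSymmetry q R) (hΨ : IsSkewInverse R Ψ) {j : ℕ} {u : U}
    {M : TensorEnd U N n} (h : TracesTo (cMat Ψ) j u n M) :
    TracesTo (cMat Ψ) (j + 1) u (n + 1) (shift hR n M) := by
  induction h with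
  | base => rw [shift_smul_one hR]; exact .base
  | step n M _ ih => exact .step _ _ (by rw [partialTrace_shift hR hΨ]; exact ih)

theorem tracesTo_zero (C : Matrix (Fin N) (Fin N) ℂ) (M : TensorEnd U N n) :
    TracesTo C 0 (rTrace C n M) n M := by
  induction n with
  | zero =>
    conv => arg 5; rw [eq_rTrace_smul_one C M]
    exact .base
  | succ n ih => exact .step _ _ (by rw [rTrace_succ]; exact ih _)

theorem tracesTo_shiftN (hR : IsHeckeSymmetry q R) (hΨ : IsSkewInverse R Ψ)
    (M : TensorEnd U N n) (j : ℕ) :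
    TracesTo (cMat Ψ) j (rTrace (cMat Ψ) n M) (n + j) (shiftN hR n j M) := by
  induction j with
  | zero => exact tracesTo_zero _ M
  | succ j ih => exact ih.shift hR hΨ

theorem rTrace_mul_smul_one (C : Matrix (Fin N) (Fin N) ℂ) (A : TensorEnd U N n) (u : U) :
    rTrace C n (A * u • 1) = rTrace C n A * u := by
  have entry (x y : Fin n → Fin N) : (A * u • 1) x y = A x y * u := by
    rw [Matrix.smul_one_eq_diagonal, Matrix.mul_diagonal]
  simp only [rTrace_eq_sum, Finset.sum_mul, smul_mul_assoc, entry]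

theorem TracesTo.le {C : Matrix (Fin N) (Fin N) ℂ} {j : ℕ} {u : U} {M : TensorEnd U N n}
    (h : TracesTo C j u n M) : j ≤ n := by
  induction h with
  | base => exact le_rfl
  | step n _ _ ih => omega

theorem TracesTo.rTrace_mul {C : Matrix (Fin N) (Fin N) ℂ} {j : ℕ} {u : U} {M : TensorEnd U N n}
    (h : TracesTo C j u n M) (hj : j ≤ n) (A : TensorEnd U N j) :
    rTrace C n (placeHom (Fin.castLEEmb hj) A * M) = rTrace C j A * u := by
  induction h with
  | base =>
    have hA : placeHom (Fin.castLEEmb hj) A = A := by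
      ext x y
      exact place_apply_pos _ A fun k hk => absurd ⟨k, rfl⟩ hk
    rw [hA, rTrace_mul_smul_one]
  | step n M h' ih =>
    have hA : placeHom (Fin.castLEEmb hj) A = tensorOne (placeHom (Fin.castLEEmb h'.le) A) := by
      rw [tensorOne, placeHom_placeHom]
      rfl
    rw [hA, rTrace_succ, partialTrace_tensorOne_mul, ih h'.le]

theorem rTrace_placeHom_mul_shiftN (hR : IsHeckeSymmetry q R) (hΨ : IsSkewInverse R Ψ) (j : ℕ)
    (A : TensorEnd U N j) (M : TensorEnd U N n) :
    rTrace (cMat Ψ) (n + j) (placeHom (Fin.castLEEmb (j.le_add_left n)) A * shiftN hR n j M) =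
      rTrace (cMat Ψ) j A * rTrace (cMat Ψ) n M :=
  (tracesTo_shiftN hR hΨ M j).rTrace_mul _ A

end Shift

/-! ### Copies of the generating matrix -/

section Copies

variable {N n : ℕ} {q : ℂ} {R Ψ : Matrix (Fin N × Fin N) (Fin N × Fin N) ℂ}

theorem copyL_succ (R : Matrix (Fin N × Fin N) (Fin N × Fin N) ℂ) (n k : ℕ) :
    copyL R n (k + 1) =
      baseChange _ (site2 n R k) * copyL R n k * baseChange _ (site2 n R⁻¹ k) := rfl

theorem shift_site2_inv (hR : IsHeckeSymmetry q R) {k : ℕ} (h : k + 1 < n) :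
    shift hR n (site2 n R⁻¹ k) = site2 (n + 1) R⁻¹ (k + 1) := by
  have hu : Units.map (shift hR n).toMonoidHom (siteUnit hR n k) = siteUnit hR (n + 1) (k + 1) :=
    Units.ext (shift_site2 hR h)
  exact congrArg (fun u : (TensorEnd ℂ N (n + 1))ˣ => (↑u⁻¹ : TensorEnd ℂ N (n + 1))) hu

theorem shift_copyL (hR : IsHeckeSymmetry q R) {k : ℕ} (h : k < n) :
    shift hR n (copyL R n k) = copyL R (n + 1) (k + 1) := by
  induction k with
  | zero => exact shift_site1 hR _ h
  | succ k ih =>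
    rw [copyL_succ, map_mul, map_mul, ← baseChange_shift, ← baseChange_shift, shift_site2 hR h,
      shift_site2_inv hR h, ih (by omega)]
    rfl

theorem shiftN_copyL (hR : IsHeckeSymmetry q R) {k : ℕ} (h : k < n) (j : ℕ) :
    shiftN hR n j (copyL R n k) = copyL R (n + j) (k + j) := by
  induction j with
  | zero => rfl
  | succ j ih => rw [shiftN_succ, ih, shift_copyL hR (by omega)]; rfl

theorem placeHom_castLE_copyL (R : Matrix (Fin N × Fin N) (Fin N × Fin N) ℂ) {j k : ℕ}
    (hj : j ≤ n) (h : k < j) : placeHom (Fin.castLEEmb hj) (copyL R j k) = copyL R n k := by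
  induction k with
  | zero => exact placeHom_castLE_site1 _ hj h
  | succ k ih =>
    have e (A : Matrix (Fin N × Fin N) (Fin N × Fin N) ℂ) : placeHom (Fin.castLEEmb hj)
        (baseChange (REAlgebra R) (site2 j A k)) = baseChange _ (site2 n A k) := by
      rw [← placeHom_castLE_site2 A hj h]
      exact (baseChange_place _ _).symm
    rw [copyL_succ, copyL_succ, map_mul, map_mul, ih (by omega), e, e]

/-- The product `L_{\overline{1}} ⋯ L_{\overline{j}}` on `n` tensor factors. -/
def partialL (R : Matrix (Fin N × Fin N) (Fin N × Fin N) ℂ) (n j : ℕ) :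
    TensorEnd (REAlgebra R) N n :=
  ((List.range j).map (copyL R n)).prod

theorem partialL_succ (R : Matrix (Fin N × Fin N) (Fin N × Fin N) ℂ) (n j : ℕ) :
    partialL R n (j + 1) = partialL R n j * copyL R n j := by
  simp only [partialL, List.range_succ, List.map_append, List.prod_append, List.map_singleton,
    List.prod_singleton]

theorem placeHom_castLE_partialL (R : Matrix (Fin N × Fin N) (Fin N × Fin N) ℂ) {j k : ℕ}
    (hj : j ≤ n) (h : k ≤ j) : placeHom (Fin.castLEEmb hj) (partialL R j k) = partialL R n k := by
  induction k with
  | zero => exact map_one _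
  | succ k ih =>
    rw [partialL_succ, partialL_succ, map_mul, ih (by omega), placeHom_castLE_copyL R hj h]

theorem partialL_mul_shiftN (hR : IsHeckeSymmetry q R) (j : ℕ) {k : ℕ} (h : k ≤ n) :
    partialL R (n + j) j * shiftN hR n j (partialL R n k) = partialL R (n + j) (k + j) := by
  induction k with
  | zero =>
    have h1 : partialL R n 0 = 1 := rfl
    rw [h1, map_one, mul_one, Nat.zero_add]
  | succ k ih =>
    rw [partialL_succ, map_mul, ← mul_assoc, ih (by omega), shiftN_copyL hR h,
      Nat.add_right_comm, partialL_succ]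

theorem prodL_add (hR : IsHeckeSymmetry q R) (n j : ℕ) :
    prodL R (n + j) =
      placeHom (Fin.castLEEmb (j.le_add_left n)) (prodL R j) * shiftN hR n j (prodL R n) :=
  (partialL_mul_shiftN hR j le_rfl).symm.trans
    (congrArg (· * _) (placeHom_castLE_partialL R _ le_rfl).symm)

theorem commute_conj {M : Type*} [Monoid M] {w : Mˣ} {l a b : M} (h : SemiconjBy ↑w b a)
    (hl : Commute l b) : Commute (↑w * l * ↑w⁻¹) a :=
  (h.mul_left hl.semiconjBy).mul_left h.units_inv_symm_left

/-- The operator `R_{k+1}` as an invertible matrix over the reflection equation algebra. -/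
def siteUnitL (hR : IsHeckeSymmetry q R) (n k : ℕ) : (TensorEnd (REAlgebra R) N n)ˣ :=
  Units.map (baseChange (REAlgebra R)).toMonoidHom (siteUnit hR n k)

theorem copyL_succ_eq_conj (hR : IsHeckeSymmetry q R) (n k : ℕ) :
    copyL R n (k + 1) = (siteUnitL hR n k).val * copyL R n k * (siteUnitL hR n k)⁻¹.val := rfl

theorem copyL_commute_of_lt (hR : IsHeckeSymmetry q R) {k i : ℕ} (h : k < i) :
    Commute (copyL R n k) (baseChange _ (site2 n R i)) := by
  induction k with
  | zero =>
    obtain ⟨i, rfl⟩ := Nat.exists_eq_succ_of_ne_zero h.ne'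
    exact site1_commute_site2 _ R n i
  | succ k ih =>
    have hki : Commute (site2 n R k) (site2 n R i) := site2_comm R n k i h
    rw [copyL_succ_eq_conj hR]
    exact commute_conj (hki.map (baseChange _)).semiconjBy (ih (by omega))

theorem copyL_commute_of_gt (hR : IsHeckeSymmetry q R) {i k : ℕ} (h : i + 2 ≤ k) (hk : k < n) :
    Commute (copyL R n k) (baseChange _ (site2 n R i)) := by
  induction k, h using Nat.le_induction with
  | base =>
    have hb : SemiconjBy (site2 n R (i + 1) * site2 n R i) (site2 n R (i + 1)) (site2 n R i) :=
      (site2_braid hR n i hk).symm.trans (mul_assoc _ _ _)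
    have hconj : copyL R n (i + 2) =
        (siteUnitL hR n (i + 1) * siteUnitL hR n i).val * copyL R n i *
          (siteUnitL hR n (i + 1) * siteUnitL hR n i)⁻¹.val := by
      rw [mul_inv_rev, Units.val_mul, Units.val_mul, copyL_succ_eq_conj hR,
        copyL_succ_eq_conj hR]
      simp only [mul_assoc]
    rw [hconj]
    refine commute_conj ?_ (copyL_commute_of_lt hR i.lt_succ_self)
    have hb' := hb.map (baseChange (REAlgebra R))
    rw [map_mul] at hb'
    exact hb'
  | succ k h ih =>
    have hik : Commute (site2 n R k) (site2 n R i) := (site2_comm R n i k h).symm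
    rw [copyL_succ_eq_conj hR]
    exact commute_conj (hik.map (baseChange _)).semiconjBy (ih (by omega))

theorem genL_reflection (R : Matrix (Fin N × Fin N) (Fin N × Fin N) ℂ) :
    baseChange _ R * (genL R ⊗ₖ 1) * baseChange _ R * (genL R ⊗ₖ 1) =
      (genL R ⊗ₖ 1) * baseChange _ R * (genL R ⊗ₖ 1) * baseChange _ R := by
  have hRmk : baseChange (REAlgebra R) R = (REAlgebra.mk R).mapMatrix (freeR R) := by
    ext u v
    exact ((REAlgebra.mk R).commutes _).symm
  have hLmk : genL R ⊗ₖ 1 = (REAlgebra.mk R).mapMatrix (freeL1 N) := by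
    ext u v
    have h : freeL1 N u v = freeL N u.1 v.1 * (1 : Matrix (Fin N) (Fin N) _) u.2 v.2 := rfl
    rw [AlgHom.mapMatrix_apply, Matrix.map_apply, h, map_mul, Matrix.kroneckerMap_apply,
      Matrix.one_apply, Matrix.one_apply, apply_ite (REAlgebra.mk R), map_one, map_zero]
    rfl
  rw [hRmk, hLmk]
  simp only [← map_mul]
  ext u v
  exact RingQuot.mkAlgHom_rel ℂ (RERel.rel u v)

theorem reflection_two (R : Matrix (Fin N × Fin N) (Fin N × Fin N) ℂ) :
    baseChange _ (site2 2 R 0) * copyL R 2 0 * baseChange _ (site2 2 R 0) * copyL R 2 0 =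
      copyL R 2 0 * baseChange _ (site2 2 R 0) * copyL R 2 0 * baseChange _ (site2 2 R 0) := by
  let e := Matrix.reindexAlgEquiv ℂ (REAlgebra R) (finTwoArrowEquiv (Fin N)).symm
  have hsite : baseChange _ (site2 2 R 0) = e (baseChange _ R) := by
    ext x y
    have h0 : site2 2 R 0 = place (fun i : Fin 2 => ⟨0 + i, by omega⟩) (pairMat R) :=
      dif_pos one_lt_two
    refine congrArg (algebraMap ℂ (REAlgebra R)) ((congrFun₂ h0 x y).trans ?_)
    exact place_apply_pos _ _ fun j hj => absurd ⟨j, Fin.ext (Nat.zero_add _)⟩ hj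
  have hcopy : copyL R 2 0 = e (genL R ⊗ₖ 1) := by
    ext x y
    have key : (∀ j, j ∉ Set.range (fun _ : Fin 1 => (0 : Fin 2)) → x j = y j) ↔ x 1 = y 1 := by
      simp [Fin.forall_fin_two]
    change site1 2 (genL R) x y = genL R (x 0) (y 0) * (1 : Matrix _ _ (REAlgebra R)) (x 1) (y 1)
    rw [site1, dif_pos two_pos, Matrix.one_apply, mul_ite, mul_one, mul_zero]
    split_ifs with h
    · exact place_apply_pos _ _ (key.2 h)
    · exact place_apply_neg _ _ fun h' => h (key.1 h')
  rw [hsite, hcopy]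
  simp only [← map_mul, genL_reflection]

theorem reflection (hR : IsHeckeSymmetry q R) {i : ℕ} (hi : i + 1 < n) :
    baseChange _ (site2 n R i) * copyL R n i * baseChange _ (site2 n R i) * copyL R n i =
      copyL R n i * baseChange _ (site2 n R i) * copyL R n i * baseChange _ (site2 n R i) := by
  have hi' : 2 + i ≤ n := by omega
  have hsite : placeHom (Fin.castLEEmb hi') (shiftN hR 2 i
      (baseChange (REAlgebra R) (site2 2 R 0))) = baseChange _ (site2 n R i) := by
    rw [← baseChange_shiftN, shiftN_site2 hR (by omega), Nat.zero_add,
      ← placeHom_castLE_site2 R hi' (by omega)]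
    exact (baseChange_place _ _).symm
  have hcopy : placeHom (Fin.castLEEmb hi') (shiftN hR 2 i (copyL R 2 0)) = copyL R n i := by
    rw [shiftN_copyL hR two_pos, Nat.zero_add, placeHom_castLE_copyL R hi' (by omega)]
  have h := congrArg (fun M => placeHom (Fin.castLEEmb hi') (shiftN hR 2 i M)) (reflection_two R)
  simpa only [map_mul, hsite, hcopy] using h

theorem copyL_mul_copyL_commute (hR : IsHeckeSymmetry q R) {i : ℕ} (hi : i + 1 < n) :
    Commute (copyL R n i * copyL R n (i + 1)) (baseChange _ (site2 n R i)) := by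
  have h := reflection hR hi
  rw [copyL_succ_eq_conj hR]
  change Commute _ (siteUnitL hR n i : TensorEnd (REAlgebra R) N n)
  change (siteUnitL hR n i : TensorEnd (REAlgebra R) N n) * _ * siteUnitL hR n i * _ =
    _ * siteUnitL hR n i * _ * siteUnitL hR n i at h
  have h' := (Units.eq_mul_inv_iff_mul_eq _).2 h.symm
  simp only [mul_assoc] at h h' ⊢
  rw [Commute, SemiconjBy]
  simp only [mul_assoc, Units.inv_mul, mul_one]
  exact h'

theorem partialL_commute (hR : IsHeckeSymmetry q R) {i k : ℕ} (h : k ≤ i) :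
    Commute (partialL R n k) (baseChange _ (site2 n R i)) := by
  induction k with
  | zero => exact Commute.one_left _
  | succ k ih =>
    rw [partialL_succ]
    exact (ih (by omega)).mul_left (copyL_commute_of_lt hR h)

theorem partialL_commute_of_ge (hR : IsHeckeSymmetry q R) {i k : ℕ} (h : i + 2 ≤ k) (hk : k ≤ n) :
    Commute (partialL R n k) (baseChange _ (site2 n R i)) := by
  induction k, h using Nat.le_induction with
  | base =>
    rw [partialL_succ, partialL_succ, mul_assoc]
    exact (partialL_commute hR le_rfl).mul_left (copyL_mul_copyL_commute hR hk)
  | succ k h ih =>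
    rw [partialL_succ]
    exact (ih (by omega)).mul_left (copyL_commute_of_gt hR h hk)

theorem prodL_commute (hR : IsHeckeSymmetry q R) (n i : ℕ) :
    Commute (prodL R n) (baseChange _ (site2 n R i)) := by
  by_cases h : i + 1 < n
  · exact partialL_commute_of_ge hR h le_rfl
  · rw [site2, dif_neg h, map_one]
    exact Commute.one_right _

end Copies

/-! ### The characteristic map -/

section CharMap

variable {N n : ℕ} {q : ℂ} {R Ψ : Matrix (Fin N × Fin N) (Fin N × Fin N) ℂ}

theorem site2_isHeckeFamily (hR : IsHeckeSymmetry q R) (n : ℕ) :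
    IsHeckeFamily q n (site2 n R) where
  hecke i h := site2_hecke hR n i h
  braid i h := site2_braid hR n i h
  comm i j h _ := site2_comm R n i j h

theorem commute_baseChange_of_mem_intervalAlgebra {U : Type*} [Ring U] [Algebra ℂ U] {a b : ℕ}
    {X : TensorEnd U N n} {Y : TensorEnd ℂ N n} (hY : Y ∈ intervalAlgebra (site2 n R) a b)
    (h : ∀ i, a ≤ i → i + 1 < b → Commute X (baseChange U (site2 n R i))) :
    Commute X (baseChange U Y) := by
  refine commute_of_mem_intervalAlgebra (t := fun i => baseChange U (site2 n R i)) ?_ h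
  have hmap := map_intervalAlgebra (t := site2 n R) (baseChange U) (a := a) (b := b) (j := 0)
    (t' := fun i => baseChange U (site2 n R i)) fun _ _ _ => rfl
  exact hmap ▸ Subalgebra.mem_map.2 ⟨Y, hY, rfl⟩

/-- The map `ch`, as a linear map on the operators `ρ_R(z)`. -/
def chLin (R Ψ : Matrix (Fin N × Fin N) (Fin N × Fin N) ℂ) (n : ℕ) :
    TensorEnd ℂ N n →ₗ[ℂ] REAlgebra R where
  toFun Z := rTrace (cMat Ψ) n (baseChange _ Z * prodL R n)
  map_add' X Y := by simp only [rTrace, map_add, add_mul, mul_add, Matrix.trace_add]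
  map_smul' c X := by
    simp only [rTrace, map_smul, smul_mul_assoc, mul_smul_comm, Matrix.trace_smul,
      RingHom.id_apply]

theorem ch_eq_chLin (hR : IsHeckeSymmetry q R) (z : HeckeAlgebra q n) :
    ch hR Ψ n z = chLin R Ψ n (rho hR n z) := rfl

theorem chLin_mul_comm (hR : IsHeckeSymmetry q R) (hΨ : IsSkewInverse R Ψ) {a b : ℕ}
    (X : TensorEnd ℂ N n) {Y : TensorEnd ℂ N n} (hY : Y ∈ intervalAlgebra (site2 n R) a b) :
    chLin R Ψ n (X * Y) = chLin R Ψ n (Y * X) := by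
  have hL : Commute (prodL R n) (baseChange _ Y) :=
    commute_baseChange_of_mem_intervalAlgebra hY fun i _ _ => prodL_commute hR n i
  have hC : Commute (tensorPow (cMat Ψ) n) Y :=
    commute_of_mem_intervalAlgebra hY fun i _ _ => tensorPow_commute_site2 hR hΨ n i
  change rTrace _ _ (baseChange _ (X * Y) * _) = rTrace _ _ (baseChange _ (Y * X) * _)
  rw [map_mul, map_mul, mul_assoc, ← hL.eq, ← mul_assoc, mul_assoc (baseChange _ Y)]
  exact (rTrace_mul_comm _ hC _).symm

theorem shiftN_mem_intervalAlgebra (hR : IsHeckeSymmetry q R) (j : ℕ) {Y : TensorEnd ℂ N n}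
    (hY : Y ∈ intervalAlgebra (site2 n R) 0 n) :
    shiftN hR n j Y ∈ intervalAlgebra (site2 (n + j) R) j (n + j) := by
  have h := map_intervalAlgebra (shiftN hR n j) (a := 0) (b := n) (t := site2 n R)
    (t' := site2 (n + j) R) fun i _ hi => shiftN_site2 hR hi j
  rw [zero_add] at h
  exact h ▸ Subalgebra.mem_map.2 ⟨Y, hY, rfl⟩

theorem chLin_placeHom_mul_shiftN (hR : IsHeckeSymmetry q R) (hΨ : IsSkewInverse R Ψ) (j : ℕ)
    (X : TensorEnd ℂ N j) {Y : TensorEnd ℂ N n} (hY : Y ∈ intervalAlgebra (site2 n R) 0 n) :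
    chLin R Ψ (n + j) (placeHom (Fin.castLEEmb (j.le_add_left n)) X * shiftN hR n j Y) =
      chLin R Ψ j X * chLin R Ψ n Y := by
  set ι : Fin j ↪ Fin (n + j) := Fin.castLEEmb (j.le_add_left n)
  have hc : Commute (placeHom ι (prodL R j)) (baseChange _ (shiftN hR n j Y)) := by
    have h := commute_baseChange_of_mem_intervalAlgebra (shiftN_mem_intervalAlgebra hR j hY)
      fun i hi _ => partialL_commute hR (n := n + j) hi
    rwa [← placeHom_castLE_partialL R (j.le_add_left n) le_rfl] at h
  calc chLin R Ψ (n + j) (placeHom ι X * shiftN hR n j Y)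
      = rTrace (cMat Ψ) (n + j) (baseChange _ (placeHom ι X) * placeHom ι (prodL R j) *
          (baseChange _ (shiftN hR n j Y) * shiftN hR n j (prodL R n))) := by
        rw [mul_assoc, ← mul_assoc (placeHom ι (prodL R j)), hc.eq, mul_assoc, ← mul_assoc,
          ← map_mul, ← prodL_add hR]
        rfl
    _ = rTrace (cMat Ψ) (n + j) (placeHom ι (baseChange _ X * prodL R j) *
          shiftN hR n j (baseChange _ Y * prodL R n)) := by
        rw [baseChange_shiftN, ← map_mul, map_mul (placeHom ι)]
        congr 2
        exact congrArg (· * _) (baseChange_place ι X)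
    _ = chLin R Ψ j X * chLin R Ψ n Y := rTrace_placeHom_mul_shiftN hR hΨ j _ _

end CharMap

/-! ### The Newton identities -/

section Newton

variable {N n : ℕ} {q : ℂ} {R Ψ : Matrix (Fin N × Fin N) (Fin N × Fin N) ℂ}

theorem rho_tau (hR : IsHeckeSymmetry q R) (n i : ℕ) :
    rho hR n (tau q n i) = site2 n R i := by
  by_cases h : i < n - 1
  · rw [tau, dif_pos h]
    exact (RingQuot.liftAlgHom_mkAlgHom_apply ..).trans (FreeAlgebra.lift_ι_apply _ _)
  · rw [tau, dif_neg h, map_one, site2, dif_neg (by omega)]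

theorem rho_tauInv (hR : IsHeckeSymmetry q R) {n i : ℕ} (h : i < n - 1) :
    rho hR n (tauInv q n i) = (site2 n R - (q - q⁻¹) • 1) i := by
  rw [tauInv, if_pos h, map_sub, map_smul, map_one, rho_tau]
  rfl

theorem antisymmetrizer_eq_asym (q : ℂ) (n : ℕ) :
    ∀ k, antisymmetrizer q n k = asym q (tau q n) k
  | 0 => rfl
  | 1 => rfl
  | k + 2 => by rw [antisymmetrizer, asym, antisymmetrizer_eq_asym q n (k + 1)]

theorem elemSymm_eq (hR : IsHeckeSymmetry q R) (n : ℕ) :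
    elemSymm hR Ψ n = chLin R Ψ n (asym q (site2 n R) n) := by
  rw [elemSymm, ch_eq_chLin, antisymmetrizer_eq_asym,
    map_asym (rho hR n) n fun i _ => rho_tau hR n i]

theorem elemSymm_zero (hR : IsHeckeSymmetry q R) : elemSymm hR Ψ 0 = 1 := by
  rw [elemSymm_eq]
  change rTrace (cMat Ψ) 0 (baseChange _ (1 : TensorEnd ℂ N 0) * 1) = 1
  rw [map_one, mul_one, rTrace_eq_sum]
  simp [tensorPow]

/-- The power sum of the factors `R_k - c I`: it is `p_n` for `c = 0` and, since
`R⁻¹ = R - (q - q⁻¹) I`, it is `t_n` for `c = q - q⁻¹`. -/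
def shiftedPowerSum (R Ψ : Matrix (Fin N × Fin N) (Fin N × Fin N) ℂ) (c : ℂ) (n : ℕ) :
    REAlgebra R :=
  chLin R Ψ n (descProd (site2 n R - c • 1) 0 (n - 1))

theorem powerSum_eq (hR : IsHeckeSymmetry q R) (n : ℕ) :
    powerSum hR Ψ n = shiftedPowerSum R Ψ 0 n := by
  rw [powerSum, ch_eq_chLin, prod_map_reverse_range,
    map_descProd (rho hR n) (k := 0) _ fun i _ _ => rho_tau hR n i, shiftedPowerSum,
    zero_smul, sub_zero]

theorem powerSum'_eq (hR : IsHeckeSymmetry q R) (n : ℕ) :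
    powerSum' hR Ψ n = shiftedPowerSum R Ψ (q - q⁻¹) n := by
  rw [powerSum', ch_eq_chLin, prod_map_reverse_range,
    map_descProd (rho hR n) (t' := site2 n R - (q - q⁻¹) • 1) (k := 0), shiftedPowerSum]
  exact fun i _ hi => rho_tauInv hR (by omega)

theorem chLin_placeHom_mul_descProd (hR : IsHeckeSymmetry q R) (hΨ : IsSkewInverse R Ψ) (c : ℂ)
    {j : ℕ} (h : j < n) (X : TensorEnd ℂ N j) :
    chLin R Ψ n (placeHom (Fin.castLEEmb h.le) X *
      descProd (site2 n R - c • 1) j (n - 1 - j)) =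
      chLin R Ψ j X * shiftedPowerSum R Ψ c (n - j) := by
  obtain ⟨k, rfl⟩ : ∃ k, n = k + 1 + j := ⟨n - 1 - j, by omega⟩
  have hY := descProd_sub_smul_mem (site2 (k + 1) R) c 0 k
  rw [zero_add] at hY
  have hshift : shiftN hR (k + 1) j (descProd (site2 (k + 1) R - c • 1) 0 k) =
      descProd (site2 (k + 1 + j) R - c • 1) (0 + j) k := by
    refine map_descProd _ k fun i _ hi => ?_
    simp only [Pi.sub_apply, Pi.smul_apply, Pi.one_apply, map_sub, map_smul, map_one]
    rw [shiftN_site2 hR (by omega)]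
  rw [show k + 1 + j - 1 - j = k by omega, Nat.add_sub_cancel, shiftedPowerSum,
    Nat.add_sub_cancel, ← chLin_placeHom_mul_shiftN hR hΨ j X hY, hshift, zero_add]

theorem chLin_asym_mul_descProd (hR : IsHeckeSymmetry q R) (hΨ : IsSkewInverse R Ψ) (c : ℂ)
    {j : ℕ} (h : j < n) :
    chLin R Ψ n (asym q (site2 n R) j * descProd (site2 n R - c • 1) j (n - 1 - j)) =
      elemSymm hR Ψ j * shiftedPowerSum R Ψ c (n - j) := by
  rw [elemSymm_eq, ← chLin_placeHom_mul_descProd hR hΨ c h, map_asym (t' := site2 n R)]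
  exact fun i hi => placeHom_castLE_site2 R h.le hi

theorem newton_identity (hq : IsGeneric q) (hR : IsHeckeSymmetry q R) (hΨ : IsSkewInverse R Ψ)
    {r c : ℂ} (hr : ∀ k, r ^ k = q ^ k - qNum q k * c) (hn : 1 ≤ n) :
    qNum q n • elemSymm hR Ψ n = ∑ i ∈ Finset.range n, ((-1) ^ (n - 1 - i) * r ^ i) •
      (elemSymm hR Ψ i * shiftedPowerSum R Ψ c (n - i)) := by
  have h := (site2_isHeckeFamily hR n).newton_recursion hq
    (fun x _ hy => chLin_mul_comm hR hΨ x hy) hr (n - 1) 0 (by omega)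
  rw [descProd, one_mul, Nat.sub_add_cancel hn, ← elemSymm_eq hR] at h
  exact h.trans <| Finset.sum_congr rfl fun i hi => by
    rw [chLin_asym_mul_descProd hR hΨ c (Finset.mem_range.1 hi)]

theorem newton_first (hq : IsGeneric q) (hR : IsHeckeSymmetry q R) (hΨ : IsSkewInverse R Ψ)
    (hn : 1 ≤ n) :
    qNum q n • elemSymm hR Ψ n = ∑ i ∈ Finset.range n, ((-1) ^ (n - 1 - i) * q ^ i) •
      (elemSymm hR Ψ i * powerSum hR Ψ (n - i)) := by
  simp only [powerSum_eq]
  exact newton_identity hq hR hΨ (fun k => by rw [mul_zero, sub_zero]) hn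

theorem newton_second (hq : IsGeneric q) (hR : IsHeckeSymmetry q R) (hΨ : IsSkewInverse R Ψ)
    (hn : 1 ≤ n) :
    qNum q n • elemSymm hR Ψ n = ∑ i ∈ Finset.range n, ((-1) ^ (n - 1 - i) * q⁻¹ ^ i) •
      (elemSymm hR Ψ i * powerSum' hR Ψ (n - i)) := by
  simp only [powerSum'_eq]
  exact newton_identity hq hR hΨ (fun k => (sub_qNum_mul hq k).symm) hn

theorem add_sum_Icc_eq_zero {V : Type*} [AddCommGroup V] [Module ℂ V] {r : ℂ}
    (f : ℕ → ℕ → V) {x : V}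
    (h : x = ∑ i ∈ Finset.range n, ((-1 : ℂ) ^ (n - 1 - i) * r ^ i) • f i (n - i)) :
    x + ∑ k ∈ Finset.Icc 1 n, ((-1 : ℂ) ^ k * r ^ ((n : ℤ) - (k : ℤ))) • f (n - k) k = 0 := by
  rw [h, add_eq_zero_iff_eq_neg, ← Finset.sum_neg_distrib]
  refine Finset.sum_nbij' (n - ·) (n - ·) ?_ ?_ ?_ ?_ ?_
  iterate 4 grind
  intro i hi
  have hi := Finset.mem_range.1 hi
  have e1 : (n : ℤ) - ((n - i : ℕ) : ℤ) = (i : ℕ) := by omega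
  have e2 : n - i = (n - 1 - i) + 1 := by omega
  rw [e1, zpow_natCast, ← neg_smul, show n - (n - i) = i by omega, e2, pow_succ]
  congr 1
  ring

theorem chLin_descProd_mul_descProd (hR : IsHeckeSymmetry q R) (hΨ : IsSkewInverse R Ψ) {i : ℕ}
    (h : i + 1 < n) :
    chLin R Ψ n (descProd (site2 n R - (q - q⁻¹) • 1) (i + 1) (n - 1 - 1 - i) *
      descProd (site2 n R) 0 i) = powerSum hR Ψ (i + 1) * powerSum' hR Ψ (n - (i + 1)) := by
  have hX : placeHom (Fin.castLEEmb h.le) (descProd (site2 (i + 1) R) 0 i) =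
      descProd (site2 n R) 0 i :=
    map_descProd (k := 0) _ i fun l _ hl => placeHom_castLE_site2 R h.le (by omega)
  have hmem := descProd_sub_smul_mem (site2 n R) 0 0 i
  rw [zero_smul, sub_zero] at hmem
  rw [chLin_mul_comm hR hΨ _ hmem, ← hX, show n - 1 - 1 - i = n - 1 - (i + 1) by omega,
    chLin_placeHom_mul_descProd hR hΨ _ h, powerSum_eq, powerSum'_eq, shiftedPowerSum,
    shiftedPowerSum, zero_smul, sub_zero, Nat.add_sub_cancel]

theorem powerSum_eq_add_sum (hR : IsHeckeSymmetry q R) (hΨ : IsSkewInverse R Ψ) (n : ℕ) :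
    powerSum hR Ψ n = powerSum' hR Ψ n + (q - q⁻¹) • ∑ k ∈ Finset.Icc 1 (n - 1),
      powerSum hR Ψ (n - k) * powerSum' hR Ψ k := by
  have h := congrArg (chLin R Ψ n) (descProd_telescope (site2 n R) (q - q⁻¹) (n - 1))
  rw [map_add, map_smul, map_sum] at h
  rw [powerSum_eq, powerSum'_eq, shiftedPowerSum, zero_smul, sub_zero, h, shiftedPowerSum]
  congr 2
  refine Finset.sum_nbij' (n - 1 - ·) (n - 1 - ·) ?_ ?_ ?_ ?_ ?_
  iterate 4 grind
  intro i hi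
  have hi := Finset.mem_range.1 hi
  rw [chLin_descProd_mul_descProd hR hΨ (by omega), show n - (n - 1 - i) = i + 1 by omega,
    show n - (i + 1) = n - 1 - i by omega]

end Newton

/-! ### The characteristic subalgebra -/

section CharacteristicSpace

variable {N n : ℕ} {q : ℂ} {R Ψ : Matrix (Fin N × Fin N) (Fin N × Fin N) ℂ}

theorem rho_range (hR : IsHeckeSymmetry q R) (n : ℕ) :
    (rho hR n).range = intervalAlgebra (site2 n R) 0 n := by
  have hlift : (rho hR n).comp (HeckeAlgebra.mk q n) =
      FreeAlgebra.lift ℂ fun i : Fin (n - 1) => site2 n R i :=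
    AlgHom.ext fun _ => RingQuot.liftAlgHom_mkAlgHom_apply ..
  have hsurj : (HeckeAlgebra.mk q n).range = ⊤ :=
    (AlgHom.range_eq_top _).2 (RingQuot.mkAlgHom_surjective ℂ _)
  calc (rho hR n).range
      = ((rho hR n).comp (HeckeAlgebra.mk q n)).range := by
        rw [AlgHom.range_comp, hsurj, Algebra.map_top]
    _ = Algebra.adjoin ℂ (Set.range fun i : Fin (n - 1) => site2 n R i) := by
        rw [hlift, Algebra.adjoin_range_eq_range_freeAlgebra_lift]
    _ = intervalAlgebra (site2 n R) 0 n := by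
        refine congrArg (Algebra.adjoin ℂ) (Set.ext fun x => ⟨?_, ?_⟩)
        · rintro ⟨i, rfl⟩
          exact ⟨i, ⟨i.1.zero_le, by omega⟩, rfl⟩
        · rintro ⟨i, ⟨_, hi⟩, rfl⟩
          exact ⟨⟨i, by omega⟩, rfl⟩

theorem mem_intervalAlgebra_iff_exists_placeHom_eq {j : ℕ} (hj : j ≤ n) {Y : TensorEnd ℂ N n} :
    Y ∈ intervalAlgebra (site2 n R) 0 j ↔
      ∃ X ∈ intervalAlgebra (site2 j R) 0 j, placeHom (Fin.castLEEmb hj) X = Y := by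
  have hmap : (intervalAlgebra (site2 j R) 0 j).map (placeHom (Fin.castLEEmb hj)) =
      intervalAlgebra (site2 n R) 0 j :=
    map_intervalAlgebra (j := 0) _ fun i _ hi => placeHom_castLE_site2 R hj hi
  rw [← hmap, Subalgebra.mem_map]

theorem chLin_mem_adjoin_powerSum (hq : IsGeneric q) (hR : IsHeckeSymmetry q R)
    (hΨ : IsSkewInverse R Ψ) (hn : 1 ≤ n) {Z : TensorEnd ℂ N n}
    (hZ : Z ∈ intervalAlgebra (site2 n R) 0 n) :
    chLin R Ψ n Z ∈ NonUnitalAlgebra.adjoin ℂ (powerSum hR Ψ '' Set.Ici 1) := by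
  induction n using Nat.strong_induction_on with
  | _ n ih =>
  set B := NonUnitalAlgebra.adjoin ℂ (powerSum hR Ψ '' Set.Ici 1)
  have hp : ∀ k, 1 ≤ k → shiftedPowerSum R Ψ 0 k ∈ B := fun k hk =>
    powerSum_eq (Ψ := Ψ) hR k ▸ NonUnitalAlgebra.subset_adjoin ℂ ⟨k, hk, rfl⟩
  refine (site2_isHeckeFamily hR n).map_mem_of_cyclic hq.1 (P := B.toSubmodule)
    (fun x _ hy => chLin_mul_comm hR hΨ x hy) (fun i hi x hx => ?_) hn hZ
  have hsub : descProd (site2 n R) i (n - 1 - i) =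
      descProd (site2 n R - (0 : ℂ) • 1) i (n - 1 - i) := by rw [zero_smul, sub_zero]
  rw [hsub]
  obtain rfl | hi0 := i.eq_zero_or_pos
  · rw [intervalAlgebra_eq_bot (Nat.zero_le _)] at hx
    obtain ⟨c, rfl⟩ := Algebra.mem_bot.1 hx
    rw [← Algebra.smul_def, map_smul]
    exact B.smul_mem c (hp n hn)
  · obtain ⟨X, hX, rfl⟩ := (mem_intervalAlgebra_iff_exists_placeHom_eq hi.le).1 hx
    rw [chLin_placeHom_mul_descProd hR hΨ 0 hi]
    exact B.mul_mem (ih i hi hi0 hX) (hp _ (by omega))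

theorem exists_ch_eq_ch_mul_ch (hR : IsHeckeSymmetry q R) (hΨ : IsSkewInverse R Ψ) {j : ℕ}
    (x : HeckeAlgebra q j) (y : HeckeAlgebra q n) :
    ∃ z : HeckeAlgebra q (n + j), ch hR Ψ (n + j) z = ch hR Ψ j x * ch hR Ψ n y := by
  have hx : rho hR j x ∈ intervalAlgebra (site2 j R) 0 j := rho_range hR j ▸ ⟨x, rfl⟩
  have hy : rho hR n y ∈ intervalAlgebra (site2 n R) 0 n := rho_range hR n ▸ ⟨y, rfl⟩
  have hj : j ≤ n + j := j.le_add_left n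
  have hmem : placeHom (Fin.castLEEmb hj) (rho hR j x) * shiftN hR n j (rho hR n y) ∈
      (rho hR (n + j)).range := rho_range hR (n + j) ▸ mul_mem
    (intervalAlgebra_mono le_rfl hj
      ((mem_intervalAlgebra_iff_exists_placeHom_eq hj).2 ⟨_, hx, rfl⟩))
    (intervalAlgebra_mono j.zero_le le_rfl (shiftN_mem_intervalAlgebra hR j hy))
  obtain ⟨z, hz⟩ := hmem
  refine ⟨z, ?_⟩
  rw [ch_eq_chLin, ch_eq_chLin, ch_eq_chLin, ← chLin_placeHom_mul_shiftN hR hΨ j _ hy, ← hz]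
  rfl

theorem mul_mem_characteristicSpace (hR : IsHeckeSymmetry q R) (hΨ : IsSkewInverse R Ψ)
    {x y : REAlgebra R} (hx : x ∈ characteristicSpace hR Ψ) (hy : y ∈ characteristicSpace hR Ψ) :
    x * y ∈ characteristicSpace hR Ψ := by
  have h := Submodule.mul_mem_mul hx hy
  rw [characteristicSpace, Submodule.span_mul_span] at h
  refine Submodule.span_le.2 ?_ h
  rintro _ ⟨_, ⟨j, hj, x, rfl⟩, _, ⟨n, hn, y, rfl⟩, rfl⟩
  obtain ⟨z, hz⟩ := exists_ch_eq_ch_mul_ch hR hΨ x y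
  exact Submodule.subset_span ⟨n + j, by omega, z, hz.symm⟩

theorem characteristicSpace_eq_adjoin_powerSum (hq : IsGeneric q) (hR : IsHeckeSymmetry q R)
    (hΨ : IsSkewInverse R Ψ) : characteristicSpace hR Ψ =
      (NonUnitalAlgebra.adjoin ℂ (powerSum hR Ψ '' Set.Ici 1)).toSubmodule := by
  apply le_antisymm
  · refine Submodule.span_le.2 ?_
    rintro _ ⟨n, hn, z, rfl⟩
    exact chLin_mem_adjoin_powerSum hq hR hΨ hn (rho_range hR n ▸ ⟨z, rfl⟩)
  · let S : NonUnitalSubalgebra ℂ (REAlgebra R) :=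
      { characteristicSpace hR Ψ with mul_mem' := mul_mem_characteristicSpace hR hΨ }
    change NonUnitalAlgebra.adjoin ℂ (powerSum hR Ψ '' Set.Ici 1) ≤ S
    refine NonUnitalAlgebra.adjoin_le ?_
    rintro _ ⟨n, hn, rfl⟩
    exact Submodule.subset_span ⟨n, hn, _, rfl⟩

end CharacteristicSpace

/-! ### Vanishing of the antisymmetrizers -/

section Append

variable {N n : ℕ}

/-- The map `v ↦ v ⊗ x_i` for a basis vector `x_i`; tensors are given by their coordinates. -/
def tmulSingle (i : Fin N) : ((Fin n → Fin N) → ℂ) →ₗ[ℂ] ((Fin (n + 1) → Fin N) → ℂ) where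
  toFun v z := if z (Fin.last n) = i then v (z ∘ Fin.castSucc) else 0
  map_add' v w := by
    ext z
    simp only [Pi.add_apply, ← ite_add_zero]
  map_smul' c v := by
    ext z
    simp only [Pi.smul_apply, smul_ite, smul_zero, RingHom.id_apply]

theorem tmulSingle_snoc (i : Fin N) (v : (Fin n → Fin N) → ℂ) (x : Fin n → Fin N) (a : Fin N) :
    tmulSingle i v (snoc x a) = if a = i then v x else 0 := by
  change (if snoc x a (Fin.last n) = i then v (snoc x a ∘ Fin.castSucc) else 0) = _
  rw [snoc_last, snoc_comp_castSucc]

theorem tmulSingle_single (x : Fin n → Fin N) (i : Fin N) :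
    tmulSingle i (Pi.single x 1) = Pi.single (snoc x i) 1 := by
  ext z
  obtain ⟨y, b, rfl⟩ := exists_eq_snoc z
  simp only [tmulSingle_snoc, Pi.single_apply, snoc_inj, ← ite_and, and_comm]

theorem tmulSingle_mulVec (i : Fin N) (M : TensorEnd ℂ N n) (v : (Fin n → Fin N) → ℂ) :
    tmulSingle i (M.mulVec v) = (tensorOne M).mulVec (tmulSingle i v) := by
  ext z
  obtain ⟨x, a, rfl⟩ := exists_eq_snoc z
  simp only [tmulSingle_snoc, Matrix.mulVec, dotProduct, sum_snoc, tensorOne_snoc, mul_ite,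
    mul_zero, Finset.sum_ite_eq', Finset.mem_univ, if_true, ite_mul, zero_mul]
  by_cases h : a = i <;> simp only [h, if_true, if_false, Finset.sum_const_zero]

theorem sum_smul_tmulSingle_tmulSingle (M : Matrix (Fin N × Fin N) (Fin N × Fin N) ℂ)
    (v : Fin N × Fin N) (w : (Fin n → Fin N) → ℂ) :
    ∑ u, M u v • tmulSingle u.2 (tmulSingle u.1 w) =
      (site2 (n + 2) M n).mulVec (tmulSingle v.2 (tmulSingle v.1 w)) := by
  ext z
  obtain ⟨y, b, rfl⟩ := exists_eq_snoc z
  obtain ⟨x, a, rfl⟩ := exists_eq_snoc y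
  simp only [Finset.sum_apply, Pi.smul_apply, tmulSingle_snoc, Matrix.mulVec, dotProduct, sum_snoc,
    site2_snoc, smul_eq_mul, mul_ite, mul_zero, ite_mul, zero_mul, Finset.sum_ite_eq,
    Finset.sum_ite_eq', Finset.mem_univ, if_true, Fintype.sum_prod_type]

theorem site2_smul_one_add (c : ℂ) (A : Matrix (Fin N × Fin N) (Fin N × Fin N) ℂ) {k : ℕ}
    (h : k + 1 < n) : site2 n (c • 1 + A) k = c • 1 + site2 n A k := by
  simp only [site2, dif_pos h, pairMat_add, pairMat_smul, pairMat_one, place_add, place_smul,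
    place_one]

end Append

section Vanishing

variable {N n : ℕ} {q : ℂ} {R Ψ : Matrix (Fin N × Fin N) (Fin N × Fin N) ℂ}

theorem asym_mul_tensorOne_asym (hq : IsGeneric q) (hR : IsHeckeSymmetry q R) (n : ℕ) :
    asym q (site2 (n + 1) R) (n + 1) * tensorOne (asym q (site2 n R) n) =
      asym q (site2 (n + 1) R) (n + 1) := by
  rw [map_asym (t' := site2 (n + 1) R) tensorOne n fun i hi => tensorOne_site2 R hi]
  exact ((site2_isHeckeFamily hR (n + 1)).asym_succ_spec hq n le_rfl).2.1

/-- The right action `v ↦ A⁽ⁿ⁺¹⁾ (v ⊗ x_i)` of the generator `x_i` of the skew-symmetric algebra on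
sequences of tensors, one of each degree. -/
def skewAct (q : ℂ) (R : Matrix (Fin N × Fin N) (Fin N × Fin N) ℂ) (i : Fin N) :
    Module.End ℂ (∀ n : ℕ, (Fin n → Fin N) → ℂ) where
  toFun v
    | 0 => 0
    | n + 1 => (asym q (site2 (n + 1) R) (n + 1)).mulVec (tmulSingle i (v n))
  map_add' v w := by
    ext n : 1
    cases n with
    | zero => exact (add_zero 0).symm
    | succ n => simp only [Pi.add_apply, map_add, Matrix.mulVec_add]
  map_smul' c v := by
    ext n : 1
    cases n with
    | zero => exact (smul_zero c).symm
    | succ n => simp only [Pi.smul_apply, map_smul, Matrix.mulVec_smul, RingHom.id_apply]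

theorem skewAct_zero (i : Fin N) (v : ∀ n : ℕ, (Fin n → Fin N) → ℂ) : skewAct q R i v 0 = 0 := rfl

theorem skewAct_succ (i : Fin N) (v : ∀ n : ℕ, (Fin n → Fin N) → ℂ) (n : ℕ) :
    skewAct q R i v (n + 1) =
      (asym q (site2 (n + 1) R) (n + 1)).mulVec (tmulSingle i (v n)) := rfl

theorem skewAct_skewAct (hq : IsGeneric q) (hR : IsHeckeSymmetry q R) (i j : Fin N)
    (v : ∀ n : ℕ, (Fin n → Fin N) → ℂ) (n : ℕ) :
    skewAct q R j (skewAct q R i v) (n + 2) =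
      (asym q (site2 (n + 2) R) (n + 2)).mulVec (tmulSingle j (tmulSingle i (v n))) := by
  rw [skewAct_succ, skewAct_succ, tmulSingle_mulVec, Matrix.mulVec_mulVec,
    asym_mul_tensorOne_asym hq hR]

theorem sum_smul_skewAct_mul_skewAct (hq : IsGeneric q) (hR : IsHeckeSymmetry q R)
    (v : Fin N × Fin N) :
    ∑ u : Fin N × Fin N, (q⁻¹ • 1 + R : Matrix (Fin N × Fin N) (Fin N × Fin N) ℂ) u v •
      (skewAct q R u.2 * skewAct q R u.1) = 0 := by
  refine LinearMap.ext fun w => funext fun n => ?_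
  simp only [LinearMap.sum_apply, LinearMap.smul_apply, Module.End.mul_apply, Finset.sum_apply,
    Pi.smul_apply, LinearMap.zero_apply, Pi.zero_apply]
  match n with
  | 0 => exact Finset.sum_eq_zero fun u _ => smul_zero _
  | 1 =>
    refine Finset.sum_eq_zero fun u _ => ?_
    rw [skewAct_succ, skewAct_zero, map_zero, Matrix.mulVec_zero, smul_zero]
  | n + 2 =>
    have h := (site2_isHeckeFamily hR (n + 2)).asym_mul hq (k := n + 2) (i := n) le_rfl (by omega)
    simp only [skewAct_skewAct hq hR, ← Matrix.mulVec_smul]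
    rw [← Matrix.mulVec_sum, sum_smul_tmulSingle_tmulSingle, Matrix.mulVec_mulVec,
      site2_smul_one_add _ _ (by omega), mul_add, h, mul_smul_comm, mul_one, neg_smul,
      add_neg_cancel, Matrix.zero_mulVec]

/-- The right action of the skew-symmetric algebra given by `skewAct`, as a homomorphism to the
opposite of the endomorphism algebra. -/
def skewRep (hq : IsGeneric q) (hR : IsHeckeSymmetry q R) :
    SkewAlgebra q R →ₐ[ℂ] (Module.End ℂ (∀ n : ℕ, (Fin n → Fin N) → ℂ))ᵐᵒᵖ :=
  RingQuot.liftAlgHom ℂ ⟨FreeAlgebra.lift ℂ fun i => MulOpposite.op (skewAct q R i), by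
    rintro _ _ ⟨v⟩
    simp only [map_sum, map_smul, map_mul, map_zero, FreeAlgebra.lift_ι_apply,
      ← MulOpposite.op_mul, ← MulOpposite.op_smul, ← Finset.op_sum,
      sum_smul_skewAct_mul_skewAct hq hR, MulOpposite.op_zero]⟩

theorem skewRep_mk_ι (hq : IsGeneric q) (hR : IsHeckeSymmetry q R) (i : Fin N) :
    skewRep hq hR (SkewAlgebra.mk q R (FreeAlgebra.ι ℂ i)) = MulOpposite.op (skewAct q R i) :=
  (RingQuot.liftAlgHom_mkAlgHom_apply ..).trans (FreeAlgebra.lift_ι_apply _ _)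

theorem skewRep_mk_prod_ofFn (hq : IsGeneric q) (hR : IsHeckeSymmetry q R) : ∀ (n : ℕ)
    (w : Fin n → Fin N),
    (skewRep hq hR (SkewAlgebra.mk q R (List.ofFn fun i => FreeAlgebra.ι ℂ (w i)).prod)).unop
      (Pi.single 0 1) n = (asym q (site2 n R) n).mulVec (Pi.single w 1)
  | 0, w => by
    rw [List.ofFn_zero, List.prod_nil, map_one, map_one, MulOpposite.unop_one,
      Module.End.one_apply, Pi.single_eq_same, asym, Matrix.one_mulVec]
    ext x
    rw [Subsingleton.elim x w, Pi.single_eq_same, Pi.one_apply]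
  | n + 1, w => by
    obtain ⟨x, a, rfl⟩ := exists_eq_snoc w
    have hword : (List.ofFn fun i => FreeAlgebra.ι ℂ (snoc x a i)).prod =
        (List.ofFn fun i => FreeAlgebra.ι ℂ (x i)).prod * FreeAlgebra.ι ℂ a := by
      simp only [List.ofFn_succ', snoc_castSucc, snoc_last, List.concat_eq_append,
        List.prod_append, List.prod_singleton]
    rw [hword, map_mul, map_mul, MulOpposite.unop_mul, Module.End.mul_apply, skewRep_mk_ι,
      MulOpposite.unop_op, skewAct_succ, skewRep_mk_prod_ofFn hq hR n x, tmulSingle_mulVec,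
      Matrix.mulVec_mulVec, asym_mul_tensorOne_asym hq hR, tmulSingle_single]

theorem asym_eq_zero (hq : IsGeneric q) (hR : IsHeckeSymmetry q R) (h : skewComponent q R n = ⊥) :
    asym q (site2 n R) n = 0 := by
  ext x w
  have hw : SkewAlgebra.mk q R (List.ofFn fun i => FreeAlgebra.ι ℂ (w i)).prod = 0 :=
    (Submodule.mem_bot ℂ).1 (h ▸ Submodule.subset_span ⟨w, rfl⟩)
  have hx := congrFun (skewRep_mk_prod_ofFn hq hR n w) x
  rw [hw, map_zero, MulOpposite.unop_zero, Matrix.mulVec_single_one] at hx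
  exact hx.symm

theorem skewComponent_eq_bot {m : ℕ} (hm : IsEvenOfBirank q R m) (h : m < n) :
    skewComponent q R n = ⊥ := by
  obtain ⟨P, hP, hdeg⟩ := hm.2
  have hcoeff := congrArg (PowerSeries.coeff n) hP
  rw [skewHilbertSeries, PowerSeries.coeff_mk, Polynomial.coeff_coe,
    Polynomial.coeff_eq_zero_of_natDegree_lt (hdeg.trans_lt h)] at hcoeff
  have : Module.Finite ℂ (skewComponent q R n) :=
    Module.Finite.span_of_finite ℂ (Set.finite_range _)
  exact Submodule.finrank_eq_zero.1 hcoeff.symm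

theorem elemSymm_eq_zero (hq : IsGeneric q) (hR : IsHeckeSymmetry q R) {m : ℕ}
    (hm : IsEvenOfBirank q R m) (h : m < n) : elemSymm hR Ψ n = 0 := by
  rw [elemSymm_eq, asym_eq_zero hq hR (skewComponent_eq_bot hm h), map_zero]

end Vanishing

/-! ### Generators of the characteristic subalgebra -/

section Triangular

variable {U : Type*} [Ring U] [Algebra ℂ U]

theorem adjoin_image_Icc_le_of_triangular {f g : ℕ → U}
    (h : ∀ n, ∀ S : NonUnitalSubalgebra ℂ U, (∀ k ∈ Set.Icc 1 (n + 1), f k ∈ S) →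
      (∀ k ∈ Set.Icc 1 n, g k ∈ S) → g (n + 1) ∈ S) (n : ℕ) :
    NonUnitalAlgebra.adjoin ℂ (g '' Set.Icc 1 n) ≤
      NonUnitalAlgebra.adjoin ℂ (f '' Set.Icc 1 n) := by
  suffices key : ∀ (S : NonUnitalSubalgebra ℂ U) (n : ℕ), (∀ k ∈ Set.Icc 1 n, f k ∈ S) →
      ∀ k ∈ Set.Icc 1 n, g k ∈ S by
    refine NonUnitalAlgebra.adjoin_le (Set.image_subset_iff.2 (key _ n fun k hk => ?_))
    exact NonUnitalAlgebra.subset_adjoin ℂ ⟨k, hk, rfl⟩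
  intro S n
  induction n with
  | zero => exact fun _ k hk => absurd (hk.1.trans hk.2) (by omega)
  | succ n ih =>
    intro hf k hk
    have hg := ih fun k hk => hf k ⟨hk.1, hk.2.trans n.le_succ⟩
    obtain rfl | hlt := hk.2.eq_or_lt
    · exact h n S hf hg
    · exact hg k ⟨hk.1, Nat.le_of_lt_succ hlt⟩

theorem adjoin_eq_adjoin_of_newton {a p : ℕ → U} {c : ℕ → ℂ} {d : ℕ → ℕ → ℂ} (ha : a 0 = 1)
    (hc : ∀ n, 1 ≤ n → c n ≠ 0) (hd : ∀ n, 1 ≤ n → d n 0 ≠ 0)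
    (h : ∀ n, 1 ≤ n → c n • a n = ∑ i ∈ Finset.range n, d n i • (a i * p (n - i))) (n : ℕ) :
    NonUnitalAlgebra.adjoin ℂ (p '' Set.Icc 1 n) =
      NonUnitalAlgebra.adjoin ℂ (a '' Set.Icc 1 n) := by
  have hsplit : ∀ n, c (n + 1) • a (n + 1) = ∑ i ∈ Finset.range n,
      d (n + 1) (i + 1) • (a (i + 1) * p (n - i)) + d (n + 1) 0 • p (n + 1) := by
    intro n
    rw [h (n + 1) (by omega), Finset.sum_range_succ', ha, one_mul, Nat.sub_zero]
    simp only [Nat.add_sub_add_right]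
  have hsum : ∀ (n : ℕ) (S : NonUnitalSubalgebra ℂ U), (∀ k ∈ Set.Icc 1 n, a k ∈ S) →
      (∀ k ∈ Set.Icc 1 n, p k ∈ S) →
      ∑ i ∈ Finset.range n, d (n + 1) (i + 1) • (a (i + 1) * p (n - i)) ∈ S :=
    fun n S ha hp => sum_mem fun i hi => by
      have hi := Finset.mem_range.1 hi
      exact SMulMemClass.smul_mem _
        (mul_mem (ha _ ⟨by omega, by omega⟩) (hp _ ⟨by omega, by omega⟩))
  apply le_antisymm <;> refine adjoin_image_Icc_le_of_triangular (fun n S hf hg => ?_) n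
  · refine (S.toSubmodule.smul_mem_iff (hd (n + 1) (by omega))).1 ?_
    rw [eq_sub_of_add_eq' (hsplit n).symm]
    exact sub_mem (S.smul_mem _ (hf _ ⟨by omega, le_rfl⟩))
      (hsum n S (fun k hk => hf k ⟨hk.1, hk.2.trans n.le_succ⟩) hg)
  · refine (S.toSubmodule.smul_mem_iff (hc (n + 1) (by omega))).1 ?_
    rw [hsplit]
    exact add_mem (hsum n S hg fun k hk => hf k ⟨hk.1, hk.2.trans n.le_succ⟩)
      (S.smul_mem _ (hf _ ⟨by omega, le_rfl⟩))

end Triangular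

section Generators

variable {N : ℕ} {q : ℂ} {R Ψ : Matrix (Fin N × Fin N) (Fin N × Fin N) ℂ}

theorem adjoin_powerSum_eq (hq : IsGeneric q) (hR : IsHeckeSymmetry q R) (hΨ : IsSkewInverse R Ψ)
    (n : ℕ) : NonUnitalAlgebra.adjoin ℂ (powerSum hR Ψ '' Set.Icc 1 n) =
      NonUnitalAlgebra.adjoin ℂ (elemSymm hR Ψ '' Set.Icc 1 n) :=
  adjoin_eq_adjoin_of_newton (elemSymm_zero hR) (fun _ hn => qNum_ne_zero hq hn)
    (fun _ _ => mul_ne_zero (pow_ne_zero _ (by norm_num)) (pow_ne_zero _ hq.1))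
    (fun _ hn => newton_first hq hR hΨ hn) n

theorem adjoin_powerSum'_eq (hq : IsGeneric q) (hR : IsHeckeSymmetry q R) (hΨ : IsSkewInverse R Ψ)
    (n : ℕ) : NonUnitalAlgebra.adjoin ℂ (powerSum' hR Ψ '' Set.Icc 1 n) =
      NonUnitalAlgebra.adjoin ℂ (elemSymm hR Ψ '' Set.Icc 1 n) :=
  adjoin_eq_adjoin_of_newton (elemSymm_zero hR) (fun _ hn => qNum_ne_zero hq hn)
    (fun _ _ => mul_ne_zero (pow_ne_zero _ (by norm_num)) (pow_ne_zero _ (inv_ne_zero hq.1)))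
    (fun _ hn => newton_second hq hR hΨ hn) n

theorem adjoin_elemSymm_eq_characteristicSpace (hq : IsGeneric q) (hR : IsHeckeSymmetry q R)
    (hΨ : IsSkewInverse R Ψ) {m : ℕ} (hm : IsEvenOfBirank q R m) :
    (NonUnitalAlgebra.adjoin ℂ (elemSymm hR Ψ '' Set.Icc 1 m)).toSubmodule =
      characteristicSpace hR Ψ := by
  rw [characteristicSpace_eq_adjoin_powerSum hq hR hΨ]
  congr 1
  apply le_antisymm
  · rw [← adjoin_powerSum_eq hq hR hΨ]
    exact NonUnitalAlgebra.adjoin_mono (Set.image_mono fun _ h => h.1)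
  · refine NonUnitalAlgebra.adjoin_le ?_
    rintro _ ⟨n, hn, rfl⟩
    have hmem : powerSum hR Ψ n ∈ NonUnitalAlgebra.adjoin ℂ (elemSymm hR Ψ '' Set.Icc 1 n) :=
      adjoin_powerSum_eq hq hR hΨ n ▸ NonUnitalAlgebra.subset_adjoin ℂ ⟨n, ⟨hn, le_rfl⟩, rfl⟩
    refine NonUnitalAlgebra.adjoin_le ?_ hmem
    rintro _ ⟨k, hk, rfl⟩
    obtain hmk | hkm := lt_or_ge m k
    · rw [elemSymm_eq_zero hq hR hm hmk]
      exact zero_mem _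
    · exact NonUnitalAlgebra.subset_adjoin ℂ ⟨k, ⟨hk.1, hkm⟩, rfl⟩

end Generators

end RE

end

theorem proposition2 (N m : ℕ) (q : ℂ) (hq : RE.IsGeneric q)
    (R : Matrix (Fin N × Fin N) (Fin N × Fin N) ℂ) (hR : RE.IsHeckeSymmetry q R)
    (Ψ : Matrix (Fin N × Fin N) (Fin N × Fin N) ℂ) (hΨ : RE.IsSkewInverse R Ψ)
    (hm : RE.IsEvenOfBirank q R m) :
    -- the quantum Newton identities of both kinds, and the relation of the two kinds of power sums
    (∀ n : ℕ, 1 ≤ n →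
      RE.qNum q n • RE.elemSymm hR Ψ n + ∑ k ∈ Finset.Icc 1 n,
        ((-1 : ℂ) ^ k * q ^ ((n : ℤ) - (k : ℤ))) •
          (RE.elemSymm hR Ψ (n - k) * RE.powerSum hR Ψ k) = 0) ∧
    (∀ n : ℕ, 1 ≤ n →
      RE.qNum q n • RE.elemSymm hR Ψ n + ∑ k ∈ Finset.Icc 1 n,
        ((-1 : ℂ) ^ k * q ^ ((k : ℤ) - (n : ℤ))) •
          (RE.elemSymm hR Ψ (n - k) * RE.powerSum' hR Ψ k) = 0) ∧
    (∀ n : ℕ, 1 ≤ n →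
      RE.powerSum hR Ψ n = RE.powerSum' hR Ψ n + (q - q⁻¹) • ∑ k ∈ Finset.Icc 1 (n - 1),
        RE.powerSum hR Ψ (n - k) * RE.powerSum' hR Ψ k) ∧
    -- the first members, and the vanishing of the higher elementary symmetric polynomials
    RE.elemSymm hR Ψ 0 = 1 ∧
    (∀ n : ℕ, m < n → RE.elemSymm hR Ψ n = 0) ∧
    -- the three families are related triangularly
    (∀ n : ℕ,
      NonUnitalAlgebra.adjoin ℂ (RE.powerSum hR Ψ '' Set.Icc 1 n) =
        NonUnitalAlgebra.adjoin ℂ (RE.elemSymm hR Ψ '' Set.Icc 1 n) ∧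
      NonUnitalAlgebra.adjoin ℂ (RE.powerSum' hR Ψ '' Set.Icc 1 n) =
        NonUnitalAlgebra.adjoin ℂ (RE.elemSymm hR Ψ '' Set.Icc 1 n)) ∧
    -- each of them generates the characteristic subalgebra
    (NonUnitalAlgebra.adjoin ℂ (RE.elemSymm hR Ψ '' Set.Icc 1 m)).toSubmodule =
      RE.characteristicSpace hR Ψ ∧
    (NonUnitalAlgebra.adjoin ℂ (RE.powerSum hR Ψ '' Set.Icc 1 m)).toSubmodule =
      RE.characteristicSpace hR Ψ ∧
    (NonUnitalAlgebra.adjoin ℂ (RE.powerSum' hR Ψ '' Set.Icc 1 m)).toSubmodule =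
      RE.characteristicSpace hR Ψ := by
  refine ⟨fun n hn => ?_, fun n hn => ?_, fun n _ => RE.powerSum_eq_add_sum hR hΨ n,
    RE.elemSymm_zero hR, fun n hn => RE.elemSymm_eq_zero hq hR hm hn,
    fun n => ⟨RE.adjoin_powerSum_eq hq hR hΨ n, RE.adjoin_powerSum'_eq hq hR hΨ n⟩,
    RE.adjoin_elemSymm_eq_characteristicSpace hq hR hΨ hm, ?_, ?_⟩
  · exact RE.add_sum_Icc_eq_zero (fun i k => RE.elemSymm hR Ψ i * RE.powerSum hR Ψ k)
      (RE.newton_first hq hR hΨ hn)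
  · have h := RE.add_sum_Icc_eq_zero (fun i k => RE.elemSymm hR Ψ i * RE.powerSum' hR Ψ k)
      (RE.newton_second hq hR hΨ hn)
    simpa only [inv_zpow', neg_sub] using h
  · rw [RE.adjoin_powerSum_eq hq hR hΨ, RE.adjoin_elemSymm_eq_characteristicSpace hq hR hΨ hm]
  · rw [RE.adjoin_powerSum'_eq hq hR hΨ, RE.adjoin_elemSymm_eq_characteristicSpace hq hR hΨ hm]
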